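/- **Proposition 3.20.** Coloured trees are finite rooted binary trees whose leaves are coloured by positive integers, and $t_1t_2$ denotes the tree with left subtree $t_1$ and right subtree $t_2$. Let $A$ be the partial map $t_1(t_2t_3)\mapsto (t_1t_2)t_3$ and $C$ the partial map $t_1t_2\mapsto t_2t_1$ on coloured trees. For an address $\alpha$ (a finite sequence of $0$'s and $1$'s, with $0$ = left, $1$ = right), $A_\alpha$ and $C_\alpha$ denote the partial maps that apply $A$, resp. $C$, to the subtree at $\alpha$. Let $\mathcal G(\mathcal A,\mathcal C)$ be the monoid generated by all $A_\alpha^{\pm1}, C_\alpha^{\pm1}$ under reversed composition ($fg$ is "first $f$, then $g$"), and let $G(\mathcal A,\mathcal C)$ be its quotient by near-equality, which is a group; two partial maps are near-equal if some tree lies in both domains and they agree on every such tree. For $i\ge 1$ put $a_i=A_{1^{i-1}}$ and $c_i=C_{1^{i-1}}$. Then $G(\mathcal A,\mathcal C)$ is generated by the elements $a_i, c_i$ $(i\ge1)$ and is presented, in terms of these generators, by the following relations, for all $i\ge 1$: - $a_i x_{j-1} = x_j a_i$ for $j\ge i+2$ and $x=a$ or $c$; - $c_i a_i^{-1} c_{i+1}^{-1}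 x_j = x_j c_i a_i^{-1} c_{i+1}^{-1}$ for $j\ge i+2$ and $x=a$ or $c$; - $a_{i+1} a_i c_i^{e} a_{i+1} = a_i^2 c_i^{e}$ for $e=\pm1$; - $a_i c_i c_{i+1} a_i = c_{i+1} c_i$; - $c_{i+1} c_i a_i^{-1} c_{i+1} = c_i a_i^{-1} c_i a_i^{-1}$; - $c_i^2=1$. Equivalently, the same relations present Thompson's group $V$, the group under composition ($(fg)(x) = f(g(x))$) of all bijections of $[0,1)$ that are affine, with slope a power of $2$ and dyadic constant term, on each interval of some finite partition of $[0,1)$ into half-open intervals with dyadic endpoints. Here $a_1\in V$ maps $[0,\frac14)\to[0,\frac12)$, $[\frac14,\frac12)\to[\frac12,\frac34)$, $[\frac12,1)\to[\frac34,1)$, increasingly and affinely on each piece; $c_1\in V$ exchanges $[0,\frac12)$ and $[\frac12,1)$ by translations; and $a_i$, $c_i$ are the identity on $[0,1-2^{-(i-1)})$ and the rescaled copies of $a_1$, $c_1$ on $[1-2^{-(i-1)},1)$. -/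

import Mathlib

namespace ACGeometry

/-! ## Coloured trees and partial operators -/

/-- Finite rooted binary trees whose leaves carry a colour, which is a positive integer.
`leaf x` is the one-vertex tree with colour `x`; `node l r` is the product tree `l · r`. -/
inductive CTree : Type
  | leaf (x : ℕ+) : CTree
  | node (l r : CTree) : CTree

/-- Partial injections of the set of coloured trees into itself.
`f t = some t'` means that `t` is in the domain of `f`, with image `t'`. -/
abbrev Op : Type := CTree ≃. CTree

/-- Partial injections form a monoid under reversed composition: `f * g` means first `f`, then `g`. -/
instance instMonoidOp : Monoid Op where
  mul f g := f.trans g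
  one := PEquiv.refl CTree
  mul_assoc f g h := PEquiv.trans_assoc f g h
  one_mul f := PEquiv.refl_trans f
  mul_one f := PEquiv.trans_refl f

/-- The associativity operator, which maps every tree `t₁(t₂t₃)` to `(t₁t₂)t₃`. -/
def opA : Op where
  toFun
    | .node t₁ (.node t₂ t₃) => some (.node (.node t₁ t₂) t₃)
    | _ => none
  invFun
    | .node (.node t₁ t₂) t₃ => some (.node t₁ (.node t₂ t₃))
    | _ => none
  inv a b := by
    rcases a with x | ⟨a, x | ⟨b', c⟩⟩ <;> rcases b with y | ⟨y | ⟨a', b''⟩, c'⟩ <;>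
      simp [and_assoc, eq_comm]

/-- The commutativity operator, which maps every tree `t₁t₂` to `t₂t₁`. -/
def opC : Op where
  toFun
    | .node t₁ t₂ => some (.node t₂ t₁)
    | _ => none
  invFun
    | .node t₁ t₂ => some (.node t₂ t₁)
    | _ => none
  inv a b := by
    rcases a with x | ⟨a, b'⟩ <;> rcases b with y | ⟨a', b''⟩ <;>
      simp [and_comm, eq_comm]

/-- Letting `f` act on the left subtree of a tree. -/
def onLeft (f : Op) : Op where
  toFun
    | .node t₁ t₂ => (f t₁).map (fun t => .node t t₂)
    | _ => none
  invFun
    | .node t₁ t₂ => (f.symm t₁).map (fun t => .node t t₂)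
    | _ => none
  inv a b := by
    rcases a with x | ⟨a, b'⟩ <;> rcases b with y | ⟨a', b''⟩ <;>
      simp [← PEquiv.eq_some_iff f, eq_comm]

/-- Letting `f` act on the right subtree of a tree. -/
def onRight (f : Op) : Op where
  toFun
    | .node t₁ t₂ => (f t₂).map (fun t => .node t₁ t)
    | _ => none
  invFun
    | .node t₁ t₂ => (f.symm t₂).map (fun t => .node t₁ t)
    | _ => none
  inv a b := by
    rcases a with x | ⟨a, b'⟩ <;> rcases b with y | ⟨a', b''⟩ <;>
      simp [← PEquiv.eq_some_iff f, eq_comm]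

/-- Addresses are finite sequences of `0`s (`false`, to the left) and `1`s (`true`, to the right).
`shift α f` is the partial map that applies `f` to the `α`-subtree of a tree, when it exists. -/
def shift : List Bool → Op → Op
  | [], f => f
  | false :: α, f => onLeft (shift α f)
  | true :: α, f => onRight (shift α f)

/-- The two kinds of letters. -/
inductive Letter : Type
  | a : Letter
  | c : Letter

/-- The basic operator attached to a kind of letter. -/
def baseOp : Letter → Op
  | .a => opA
  | .c => opC

/-- The geometry monoid of associativity and commutativity: the monoid generated by all
operators `A_α`, `C_α` and their inverses, under reversed composition. -/
def geomMonoid : Submonoid Op :=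
  Submonoid.closure
    {f | ∃ (α : List Bool) (x : Letter), f = shift α (baseOp x) ∨ f = (shift α (baseOp x)).symm}

/-- Two partial maps are near-equal if there is at least one tree on which both are defined, and
they agree on every tree on which both are defined. -/
def NearEq (f g : Op) : Prop :=
  (∃ t, (f t).isSome ∧ (g t).isSome) ∧ ∀ t, (f t).isSome → (g t).isSome → f t = g t

/-! ### Near-equality is a congruence on the geometry monoid -/

namespace CTree

/-- Substitution of trees for the leaves. -/
def subst (σ : ℕ+ → CTree) : CTree → CTree
  | leaf x => σ x
  | node l r => node (subst σ l) (subst σ r)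

/-- The length of the shortest branch. -/
def minDepth : CTree → ℕ
  | leaf _ => 0
  | node l r => min (minDepth l) (minDepth r) + 1

/-- The complete tree of height `n` with all leaves of colour `x`. -/
def full : ℕ → ℕ+ → CTree
  | 0, x => leaf x
  | n + 1, x => node (full n x) (full n x)

theorem minDepth_full (n : ℕ) (x : ℕ+) : (full n x).minDepth = n := by
  induction n with
  | zero => rfl
  | succ n ih => simp [full, minDepth, ih]

theorem le_minDepth_subst_full (n : ℕ) (t : CTree) : n ≤ (t.subst (full n)).minDepth := by
  induction t with
  | leaf x => simp [subst, minDepth_full]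
  | node l r ihl ihr => simp only [subst, minDepth]; omega

theorem full_ne (n : ℕ) (x : ℕ+) (l r : CTree) :
    full n x ≠ node (l.subst (full n)) (r.subst (full n)) := by
  intro h
  have h' := congrArg minDepth h
  have hl := le_minDepth_subst_full n l
  have hr := le_minDepth_subst_full n r
  rw [minDepth_full] at h'
  simp only [minDepth] at h'
  omega

theorem full_injective (n : ℕ) (x y : ℕ+) (h : full n x = full n y) : x = y := by
  induction n with
  | zero => exact leaf.inj h
  | succ n ih => exact ih (node.inj h).1

theorem subst_full_injective (n : ℕ) (s t : CTree)
    (h : s.subst (full n) = t.subst (full n)) : s = t := by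
  induction s generalizing t with
  | leaf x =>
    cases t with
    | leaf y => rw [full_injective n x y h]
    | node l r => exact absurd h (full_ne n x l r)
  | node l r ihl ihr =>
    cases t with
    | leaf y => exact absurd h.symm (full_ne n y l r)
    | node l' r' =>
      have h' := node.inj h
      rw [ihl _ h'.1, ihr _ h'.2]

end CTree

open CTree

/-- `f` is compatible with substitutions, and is defined on all sufficiently deep trees. -/
structure Tame (f : Op) : Prop where
  subst : ∀ (σ : ℕ+ → CTree) (t t' : CTree), f t = some t' → f (t.subst σ) = some (t'.subst σ)
  deep : ∃ n : ℕ, ∀ (m : ℕ) (t : CTree), n + m ≤ t.minDepth →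
    ∃ t', f t = some t' ∧ m ≤ t'.minDepth

theorem mul_apply_of_eq {f g : Op} {t t' : CTree} (h : f t = some t') : (f * g) t = g t' := by
  change (f t).bind g = g t'
  rw [h]; rfl

theorem tame_one : Tame 1 where
  subst σ t t' h := by
    have h' : t = t' := Option.some.inj h
    rw [h']; rfl
  deep := ⟨0, fun m t h => ⟨t, rfl, by omega⟩⟩

theorem Tame.mul {f g : Op} (hf : Tame f) (hg : Tame g) : Tame (f * g) where
  subst σ t t' h := by
    change (f t).bind g = some t' at h
    obtain ⟨u, hu, hu'⟩ := Option.bind_eq_some_iff.1 h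
    rw [mul_apply_of_eq (hf.subst σ t u hu)]
    exact hg.subst σ u t' hu'
  deep := by
    obtain ⟨n, hn⟩ := hf.deep
    obtain ⟨k, hk⟩ := hg.deep
    refine ⟨n + k, fun m t h => ?_⟩
    obtain ⟨u, hu, hu'⟩ := hn (k + m) t (by omega)
    obtain ⟨v, hv, hv'⟩ := hk m u hu'
    exact ⟨v, by rw [mul_apply_of_eq hu, hv], hv'⟩

theorem tame_opA : Tame opA where
  subst σ t t' h := by
    rcases t with x | ⟨a, x | ⟨b, c⟩⟩
    · cases h
    · cases h
    · cases h; rfl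
  deep := by
    refine ⟨2, fun m t h => ?_⟩
    rcases t with x | ⟨a, x | ⟨b, c⟩⟩
    · simp [minDepth] at h
    · simp only [minDepth] at h; omega
    · exact ⟨_, rfl, by simp only [minDepth] at h ⊢; omega⟩

theorem tame_opA_symm : Tame opA.symm where
  subst σ t t' h := by
    rcases t with x | ⟨x | ⟨a, b⟩, c⟩
    · cases h
    · cases h
    · cases h; rfl
  deep := by
    refine ⟨2, fun m t h => ?_⟩
    rcases t with x | ⟨x | ⟨a, b⟩, c⟩
    · simp [minDepth] at h
    · simp only [minDepth] at h; omega
    · exact ⟨_, rfl, by simp only [minDepth] at h ⊢; omega⟩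

theorem tame_opC : Tame opC where
  subst σ t t' h := by
    rcases t with x | ⟨a, b⟩
    · cases h
    · cases h; rfl
  deep := by
    refine ⟨1, fun m t h => ?_⟩
    rcases t with x | ⟨a, b⟩
    · simp only [minDepth] at h; omega
    · exact ⟨_, rfl, by simp only [minDepth] at h ⊢; omega⟩

theorem Tame.onLeft {f : Op} (hf : Tame f) : Tame (onLeft f) where
  subst σ t t' h := by
    rcases t with x | ⟨a, b⟩
    · cases h
    · change (f a).map _ = some t' at h
      obtain ⟨u, hu, rfl⟩ := Option.map_eq_some_iff.1 h
      change (f (a.subst σ)).map _ = _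
      rw [hf.subst σ a u hu]; rfl
  deep := by
    obtain ⟨n, hn⟩ := hf.deep
    refine ⟨n + 1, fun m t h => ?_⟩
    rcases t with x | ⟨a, b⟩
    · simp only [minDepth] at h; omega
    · simp only [minDepth] at h
      obtain ⟨u, hu, hu'⟩ := hn m a (by omega)
      refine ⟨.node u b, ?_, by simp only [minDepth]; omega⟩
      change (f a).map _ = _
      rw [hu]; rfl

theorem Tame.onRight {f : Op} (hf : Tame f) : Tame (onRight f) where
  subst σ t t' h := by
    rcases t with x | ⟨a, b⟩
    · cases h
    · change (f b).map _ = some t' at h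
      obtain ⟨u, hu, rfl⟩ := Option.map_eq_some_iff.1 h
      change (f (b.subst σ)).map _ = _
      rw [hf.subst σ b u hu]; rfl
  deep := by
    obtain ⟨n, hn⟩ := hf.deep
    refine ⟨n + 1, fun m t h => ?_⟩
    rcases t with x | ⟨a, b⟩
    · simp only [minDepth] at h; omega
    · simp only [minDepth] at h
      obtain ⟨u, hu, hu'⟩ := hn m b (by omega)
      refine ⟨.node a u, ?_, by simp only [minDepth]; omega⟩
      change (f b).map _ = _
      rw [hu]; rfl

theorem tame_shift (α : List Bool) {f : Op} (hf : Tame f) : Tame (shift α f) := by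
  induction α with
  | nil => exact hf
  | cons b α ih => cases b; exacts [ih.onLeft, ih.onRight]

theorem onLeft_symm (f : Op) : (onLeft f).symm = onLeft f.symm := by
  ext t; cases t <;> rfl

theorem onRight_symm (f : Op) : (onRight f).symm = onRight f.symm := by
  ext t; cases t <;> rfl

theorem shift_symm (α : List Bool) (f : Op) : (shift α f).symm = shift α f.symm := by
  induction α with
  | nil => rfl
  | cons b α ih => cases b <;> simp [shift, onLeft_symm, onRight_symm, ih]

theorem tame_of_mem {f : Op} (hf : f ∈ geomMonoid) : Tame f := by
  refine Submonoid.closure_induction (fun f hf => ?_) tame_one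
    (fun f g _ _ hf hg => hf.mul hg) hf
  obtain ⟨α, x, rfl | rfl⟩ := hf
  · cases x
    exacts [tame_shift α tame_opA, tame_shift α tame_opC]
  · rw [shift_symm]
    cases x
    exacts [tame_shift α tame_opA_symm, tame_shift α tame_opC]

theorem symm_mem {f : Op} (hf : f ∈ geomMonoid) : f.symm ∈ geomMonoid := by
  refine Submonoid.closure_induction (fun f hf => ?_) ?_ (fun f g _ _ hf hg => ?_) hf
  · obtain ⟨α, x, rfl | rfl⟩ := hf
    · exact Submonoid.subset_closure ⟨α, x, Or.inr rfl⟩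
    · exact Submonoid.subset_closure ⟨α, x, Or.inl (PEquiv.symm_symm _)⟩
  · exact one_mem geomMonoid
  · have h : (f * g).symm = g.symm * f.symm := PEquiv.symm_trans_rev f g
    rw [h]
    exact mul_mem hg hf

theorem Tame.exists_deep {f g : Op} (hf : Tame f) (hg : Tame g) :
    ∃ n : ℕ, ∀ t : CTree, n ≤ t.minDepth → (f t).isSome ∧ (g t).isSome := by
  obtain ⟨n, hn⟩ := hf.deep
  obtain ⟨k, hk⟩ := hg.deep
  refine ⟨n + k, fun t ht => ?_⟩
  obtain ⟨u, hu, -⟩ := hn 0 t (by omega)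
  obtain ⟨v, hv, -⟩ := hk 0 t (by omega)
  simp [hu, hv]

theorem Tame.exists_common {f g : Op} (hf : Tame f) (hg : Tame g) :
    ∃ t, (f t).isSome ∧ (g t).isSome := by
  obtain ⟨n, hn⟩ := hf.exists_deep hg
  exact ⟨full n 1, hn _ (minDepth_full n 1).ge⟩

theorem NearEq.symm {f g : Op} (h : NearEq f g) : NearEq g f :=
  ⟨by obtain ⟨t, h₁, h₂⟩ := h.1; exact ⟨t, h₂, h₁⟩, fun t h₁ h₂ => (h.2 t h₂ h₁).symm⟩

theorem NearEq.trans {f g h : Op} (hf : Tame f) (hg : Tame g) (hh : Tame h)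
    (hfg : NearEq f g) (hgh : NearEq g h) : NearEq f h := by
  refine ⟨hf.exists_common hh, fun t h₁ h₂ => ?_⟩
  obtain ⟨u, hu⟩ := Option.isSome_iff_exists.1 h₁
  obtain ⟨v, hv⟩ := Option.isSome_iff_exists.1 h₂
  obtain ⟨n, hn⟩ := hg.exists_deep hg
  have hd := (hn (t.subst (full n)) (le_minDepth_subst_full n t)).1
  have hu' := hf.subst (full n) t u hu
  have hv' := hh.subst (full n) t v hv
  have e₁ := hfg.2 (t.subst (full n)) (by simp [hu']) hd
  have e₂ := hgh.2 (t.subst (full n)) hd (by simp [hv'])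
  rw [hu'] at e₁
  rw [hv', ← e₁] at e₂
  rw [hu, hv, subst_full_injective n u v (Option.some.inj e₂)]

theorem NearEq.mul {f f' g g' : Op} (hf : Tame f) (hf' : Tame f') (hg : Tame g) (hg' : Tame g')
    (h : NearEq f f') (k : NearEq g g') : NearEq (f * g) (f' * g') := by
  refine ⟨(hf.mul hg).exists_common (hf'.mul hg'), fun t h₁ h₂ => ?_⟩
  obtain ⟨u, hu⟩ := Option.isSome_iff_exists.1 h₁
  obtain ⟨v, hv⟩ := Option.isSome_iff_exists.1 h₂
  obtain ⟨u₁, hu₁, hu₂⟩ := Option.bind_eq_some_iff.1 (show (f t).bind g = some u from hu)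
  obtain ⟨v₁, hv₁, hv₂⟩ := Option.bind_eq_some_iff.1 (show (f' t).bind g' = some v from hv)
  have e : u₁ = v₁ := by
    have := h.2 t (by simp [hu₁]) (by simp [hv₁])
    rw [hu₁, hv₁] at this
    exact Option.some.inj this
  subst e
  rw [hu, hv, ← hu₂, ← hv₂]
  exact k.2 u₁ (by simp [hu₂]) (by simp [hv₂])

/-- Near-equality, as a congruence on the geometry monoid. -/
def nearCon : Con geomMonoid where
  r f g := NearEq f g
  iseqv :=
    { refl := fun f =>
        ⟨(tame_of_mem f.2).exists_common (tame_of_mem f.2), fun _ _ _ => rfl⟩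
      symm := fun h => NearEq.symm h
      trans := fun {f g h} h₁ h₂ =>
        NearEq.trans (tame_of_mem f.2) (tame_of_mem g.2) (tame_of_mem h.2) h₁ h₂ }
  mul' := fun {f f' g g'} h k =>
    NearEq.mul (tame_of_mem f.2) (tame_of_mem f'.2) (tame_of_mem g.2) (tame_of_mem g'.2) h k

/-- The geometry group of associativity and commutativity: the quotient of the geometry monoid
by near-equality. -/
def GeomGroup : Type := nearCon.Quotient

theorem nearEq_symm_mul (f : Op) (hf : Tame f) (hf' : Tame f.symm) : NearEq (f.symm * f) 1 := by
  refine ⟨(hf'.mul hf).exists_common tame_one, fun t h₁ _ => ?_⟩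
  obtain ⟨u, hu⟩ := Option.isSome_iff_exists.1 h₁
  obtain ⟨v, hv, hv'⟩ := Option.bind_eq_some_iff.1 (show (f.symm t).bind f = some u from hu)
  rw [hu, ← hv', (PEquiv.eq_some_iff f).1 hv]
  rfl

theorem nearEq_symm_mul' (f : Op) (hf : Tame f) (hf' : Tame f.symm) : NearEq (f * f.symm) 1 := by
  have h := nearEq_symm_mul f.symm hf' (by rwa [PEquiv.symm_symm])
  rwa [PEquiv.symm_symm] at h

/-- The geometry group is a group: the inverse of the class of `f` is the class of the inverse
partial map. The multiplication is the one of the quotient monoid. -/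
noncomputable instance instGroupGeomGroup : Group GeomGroup :=
  letI : Monoid GeomGroup := inferInstanceAs (Monoid nearCon.Quotient)
  groupOfIsUnit (fun x => by
    obtain ⟨f, rfl⟩ := Con.mk'_surjective (c := nearCon) x
    have h := tame_of_mem f.2
    have h' := tame_of_mem (symm_mem f.2)
    exact ⟨⟨nearCon.mk' f, nearCon.mk' ⟨_, symm_mem f.2⟩,
      (Con.eq nearCon).2 (nearEq_symm_mul' f h h'),
      (Con.eq nearCon).2 (nearEq_symm_mul f h h')⟩, rfl⟩)

theorem shift_mem (α : List Bool) (x : Letter) : shift α (baseOp x) ∈ geomMonoid :=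
  Submonoid.subset_closure ⟨α, x, Or.inl rfl⟩

/-- The class of `A_α` (for `x = a`) or of `C_α` (for `x = c`) in the geometry group. -/
def geomClass (x : Letter) (α : List Bool) : GeomGroup :=
  nearCon.toQuotient ⟨shift α (baseOp x), shift_mem α x⟩

/-! ## The presentation -/

/-- The letters `a₁, a₂, …` and `c₁, c₂, …`. Indices are shifted by one so as to start from `0`:
`(x, i)` stands for the letter `x_{i+1}`. -/
abbrev Gen : Type := Letter × ℕ

/-- The generators of the geometry group: `a_{i+1} ↦ A_{1^i}` and `c_{i+1} ↦ C_{1^i}`. -/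
def geomGen (g : Gen) : GeomGroup := geomClass g.1 (List.replicate g.2 true)

/-- A letter, as an element of the free group. -/
def letter (x : Letter) (i : ℕ) : FreeGroup Gen := FreeGroup.of (x, i)

/-- The relations `u = v` of the family `R_ac`, completed with the torsion relations `c_i² = 1`.
All relations are stable under a shift of the indices, so that they keep their form when the
indices start from `0`. -/
inductive RacRel : FreeGroup Gen → FreeGroup Gen → Prop
  /-- `a_i x_{j-1} = x_j a_i` for `j ≥ i + 2` and `x = a` or `c` -/
  | shift (x : Letter) (i j : ℕ) (h : i + 2 ≤ j) :
      RacRel (letter .a i * letter x (j - 1)) (letter x j * letter .a i)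
  /-- `c_i a_i⁻¹ c_{i+1}⁻¹ x_j = x_j c_i a_i⁻¹ c_{i+1}⁻¹` for `j ≥ i + 2` and `x = a` or `c` -/
  | comm (x : Letter) (i j : ℕ) (h : i + 2 ≤ j) :
      RacRel (letter .c i * (letter .a i)⁻¹ * (letter .c (i + 1))⁻¹ * letter x j)
        (letter x j * letter .c i * (letter .a i)⁻¹ * (letter .c (i + 1))⁻¹)
  /-- `a_{i+1} a_i c_i^e a_{i+1} = a_i² c_i^e` for `e = ±1` -/
  | pentagon (i : ℕ) (e : ℤ) (h : e = 1 ∨ e = -1) :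
      RacRel (letter .a (i + 1) * letter .a i * letter .c i ^ e * letter .a (i + 1)) (letter .a i ^ 2 * letter .c i ^ e)
  /-- `a_i c_i c_{i+1} a_i = c_{i+1} c_i` -/
  | hexagon (i : ℕ) :
      RacRel (letter .a i * letter .c i * letter .c (i + 1) * letter .a i) (letter .c (i + 1) * letter .c i)
  /-- `c_{i+1} c_i a_i⁻¹ c_{i+1} = c_i a_i⁻¹ c_i a_i⁻¹` -/
  | hexagon₂ (i : ℕ) :
      RacRel (letter .c (i + 1) * letter .c i * (letter .a i)⁻¹ * letter .c (i + 1)) (letter .c i * (letter .a i)⁻¹ * letter .c i * (letter .a i)⁻¹)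
  /-- `c_i² = 1` -/
  | torsion (i : ℕ) : RacRel (letter .c i ^ 2) 1

/-- The relators `u v⁻¹` attached to the relations `u = v`. -/
def relators : Set (FreeGroup Gen) := {w | ∃ u v, RacRel u v ∧ w = u * v⁻¹}

/-- The elements `g x`, for `x` in `X`, together with the relators `R` make a presentation of the
group `G`: they generate `G`, and a word in them represents `1` in `G` exactly when it is a
consequence of `R`. -/
def IsPresentation {X G : Type*} [Group G] (g : X → G) (R : Set (FreeGroup X)) : Prop :=
  Function.Surjective (FreeGroup.lift g) ∧
    (FreeGroup.lift g).ker = Subgroup.normalClosure R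

/-! ## Thompson's group `V` -/

/-- Dyadic rational numbers. -/
def IsDyadic (d : ℝ) : Prop := ∃ (p : ℤ) (m : ℕ), d = p / 2 ^ m

/-- The half-open unit interval. -/
abbrev UnitIco : Type := Set.Ico (0 : ℝ) 1

/-- `g` is dyadic piecewise linear: for some `n`, on each of the `2^n` intervals
`[j/2^n, (j+1)/2^n)`, it coincides with an affine map whose slope is a power of `2` and whose
constant term is dyadic. (Any finite set of dyadic breakpoints is contained in the set of
multiples of `1/2^n` for `n` large enough.) -/
def IsDyadicPL (g : UnitIco → UnitIco) : Prop :=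
  ∃ n : ℕ, ∀ j : Fin (2 ^ n), ∃ (k : ℤ) (d : ℝ), IsDyadic d ∧
    ∀ x : UnitIco, (j : ℝ) / 2 ^ n ≤ x → (x : ℝ) < ((j : ℝ) + 1) / 2 ^ n →
      (g x : ℝ) = 2 ^ k * (x : ℝ) + d

namespace IsDyadic

theorem intCast (p : ℤ) : IsDyadic p := ⟨p, 0, by simp⟩

theorem add {c d : ℝ} (hc : IsDyadic c) (hd : IsDyadic d) : IsDyadic (c + d) := by
  obtain ⟨p, m, rfl⟩ := hc
  obtain ⟨q, k, rfl⟩ := hd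
  refine ⟨p * 2 ^ k + q * 2 ^ m, m + k, ?_⟩
  push_cast
  field_simp
  ring

theorem mul {c d : ℝ} (hc : IsDyadic c) (hd : IsDyadic d) : IsDyadic (c * d) := by
  obtain ⟨p, m, rfl⟩ := hc
  obtain ⟨q, k, rfl⟩ := hd
  refine ⟨p * q, m + k, ?_⟩
  push_cast
  field_simp
  ring

theorem neg {c : ℝ} (hc : IsDyadic c) : IsDyadic (-c) := by
  simpa using (intCast (-1)).mul hc

theorem zpow (k : ℤ) : IsDyadic ((2 : ℝ) ^ k) := by
  obtain ⟨n, rfl | rfl⟩ := k.eq_nat_or_neg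
  · exact ⟨2 ^ n, 0, by simp⟩
  · exact ⟨1, n, by simp⟩

/-- A dyadic number is a multiple of `1/2^N` for all sufficiently large `N`. -/
theorem eventually {d : ℝ} (hd : IsDyadic d) : ∃ m : ℕ, ∀ N : ℕ, m ≤ N → ∃ p : ℤ, 2 ^ N * d = p := by
  obtain ⟨p, m, rfl⟩ := hd
  refine ⟨m, fun N hN => ⟨p * 2 ^ (N - m), ?_⟩⟩
  obtain ⟨r, rfl⟩ := Nat.exists_eq_add_of_le hN
  simp only [Nat.add_sub_cancel_left]
  push_cast
  rw [pow_add]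
  field_simp

end IsDyadic

/-- Uniform bounds for the affine pieces, indexed by the integer part of `2^n x`. -/
theorem IsDyadicPL.exists_level {g : UnitIco → UnitIco} (hg : IsDyadicPL g) :
    ∃ n M : ℕ, ∀ x : UnitIco, ∃ (k : ℤ) (d : ℝ), |k| ≤ M ∧ IsDyadic d ∧
      (∀ N : ℕ, M ≤ N → ∃ p : ℤ, 2 ^ N * d = p) ∧
      ∀ y : UnitIco, ⌊2 ^ n * (y : ℝ)⌋ = ⌊2 ^ n * (x : ℝ)⌋ → (g y : ℝ) = 2 ^ k * (y : ℝ) + d := by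
  obtain ⟨n, hn⟩ := hg
  choose k d hd h using hn
  choose m hm using fun j => (hd j).eventually
  refine ⟨n, (∑ j, (k j).natAbs) + ∑ j, m j, fun x => ?_⟩
  have h2 : (0 : ℝ) < 2 ^ n := by positivity
  have hx0 : (0 : ℝ) ≤ 2 ^ n * (x : ℝ) := mul_nonneg h2.le x.2.1
  have hx1 : (2 : ℝ) ^ n * (x : ℝ) < 2 ^ n := by nlinarith [x.2.2]
  have hj0 : 0 ≤ ⌊2 ^ n * (x : ℝ)⌋ := Int.floor_nonneg.2 hx0
  obtain ⟨j, hj⟩ := Int.eq_ofNat_of_zero_le hj0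
  have hj1 : j < 2 ^ n := by
    have h := (Int.floor_le (2 ^ n * (x : ℝ))).trans_lt hx1
    rw [hj] at h
    exact_mod_cast h
  have b₁ := Finset.single_le_sum (f := fun j => (k j).natAbs) (fun _ _ => Nat.zero_le _)
    (Finset.mem_univ ⟨j, hj1⟩)
  have b₂ := Finset.single_le_sum (f := m) (fun _ _ => Nat.zero_le _)
    (Finset.mem_univ ⟨j, hj1⟩)
  refine ⟨k ⟨j, hj1⟩, d ⟨j, hj1⟩, ?_, hd _, fun N hN => hm _ N (by omega),
    fun y hy => h ⟨j, hj1⟩ y ?_ ?_⟩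
  · rw [Int.abs_eq_natAbs]
    exact_mod_cast b₁.trans (Nat.le_add_right _ _)
  · have := Int.floor_le (2 ^ n * (y : ℝ))
    rw [hy, hj] at this
    rw [div_le_iff₀ h2, mul_comm]
    exact_mod_cast this
  · have := Int.lt_floor_add_one (2 ^ n * (y : ℝ))
    rw [hy, hj] at this
    rw [lt_div_iff₀ h2, mul_comm]
    exact_mod_cast this

theorem isDyadicPL_of_level {g : UnitIco → UnitIco} (n : ℕ)
    (hn : ∀ x : UnitIco, ∃ (k : ℤ) (d : ℝ), IsDyadic d ∧
      ∀ y : UnitIco, ⌊2 ^ n * (y : ℝ)⌋ = ⌊2 ^ n * (x : ℝ)⌋ → (g y : ℝ) = 2 ^ k * (y : ℝ) + d) :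
    IsDyadicPL g := by
  refine ⟨n, fun j => ?_⟩
  have h2 : (0 : ℝ) < 2 ^ n := by positivity
  have hj : ((j : ℕ) : ℝ) < 2 ^ n := by exact_mod_cast j.2
  obtain ⟨k, d, hd, h⟩ := hn ⟨(j : ℝ) / 2 ^ n, by positivity, by rwa [div_lt_one h2]⟩
  refine ⟨k, d, hd, fun y h₁ h₂ => h y ?_⟩
  rw [div_le_iff₀ h2, mul_comm] at h₁
  rw [lt_div_iff₀ h2, mul_comm] at h₂
  have e : (2 : ℝ) ^ n * ((j : ℝ) / 2 ^ n) = ((j : ℕ) : ℤ) := by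
    field_simp
    simp
  rw [e, Int.floor_intCast, Int.floor_eq_iff]
  exact ⟨by exact_mod_cast h₁, by exact_mod_cast h₂⟩

/-- A dyadic affine map sends each small enough standard dyadic interval into a standard dyadic
interval of a given level. -/
theorem floor_affine {n N : ℕ} {k : ℤ} {d : ℝ} (hk : n + k ≤ N)
    (hd : ∃ p : ℤ, (2 : ℝ) ^ ((N : ℤ) - k) * d = p) {u v : ℝ}
    (h : ⌊2 ^ N * u⌋ = ⌊2 ^ N * v⌋) :
    ⌊2 ^ n * (2 ^ k * u + d)⌋ = ⌊2 ^ n * (2 ^ k * v + d)⌋ := by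
  obtain ⟨p, hp⟩ := hd
  obtain ⟨r, hr⟩ := Int.eq_ofNat_of_zero_le (sub_nonneg.2 hk)
  have key : ∀ (q : ℤ) (w : ℝ), q ≤ ⌊2 ^ n * (2 ^ k * w + d)⌋ ↔ 2 ^ r * q - p ≤ ⌊2 ^ N * w⌋ := by
    intro q w
    rw [Int.le_floor, Int.le_floor]
    have hr2 : (0 : ℝ) < 2 ^ r := by positivity
    have e₁ : (2 : ℝ) ^ r * (2 ^ n * 2 ^ k) = 2 ^ N := by
      rw [← zpow_natCast, ← zpow_natCast, ← zpow_natCast, ← zpow_add₀ two_ne_zero,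
        ← zpow_add₀ two_ne_zero]
      congr 1
      omega
    have e₂ : (2 : ℝ) ^ r * 2 ^ n * d = p := by
      rw [← hp, ← zpow_natCast, ← zpow_natCast, ← zpow_add₀ two_ne_zero]
      congr 2
      omega
    have e₃ : (2 : ℝ) ^ r * (2 ^ n * (2 ^ k * w + d)) = 2 ^ N * w + p := by
      rw [← e₁, ← e₂]; ring
    rw [← mul_le_mul_iff_right₀ hr2, e₃]
    push_cast
    exact sub_le_iff_le_add.symm
  refine le_antisymm ?_ ?_
  · rw [key, ← h, ← key]
  · rw [key, h, ← key]

theorem floor_coarsen {n N : ℕ} (hn : n ≤ N) {u v : ℝ} (h : ⌊2 ^ N * u⌋ = ⌊2 ^ N * v⌋) :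
    ⌊2 ^ n * u⌋ = ⌊2 ^ n * v⌋ := by
  have := floor_affine (n := n) (N := N) (k := 0) (d := 0) (by omega) ⟨0, by simp⟩ h
  simpa using this

theorem IsDyadicPL.comp {g f : UnitIco → UnitIco} (hg : IsDyadicPL g) (hf : IsDyadicPL f) :
    IsDyadicPL (g ∘ f) := by
  obtain ⟨n, M, hn⟩ := hg.exists_level
  obtain ⟨m, K, hm⟩ := hf.exists_level
  refine isDyadicPL_of_level (m + n + 2 * K) fun x => ?_
  obtain ⟨k, d, hk, hd, hd', h⟩ := hm x
  obtain ⟨l, e, hl, he, -, h'⟩ := hn (f x)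
  refine ⟨l + k, 2 ^ l * d + e, ((IsDyadic.zpow l).mul hd).add he, fun y hy => ?_⟩
  have hy₁ := h y (floor_coarsen (by omega) hy)
  have hk' := abs_le.1 hk
  have hy₂ : ⌊2 ^ n * (f y : ℝ)⌋ = ⌊2 ^ n * (f x : ℝ)⌋ := by
    rw [hy₁, h x rfl]
    refine floor_affine (by push_cast; omega) ?_ hy
    obtain ⟨r, hr⟩ := Int.eq_ofNat_of_zero_le
      (show 0 ≤ ((m + n + 2 * K : ℕ) : ℤ) - k by push_cast; omega)
    rw [hr, zpow_natCast]
    exact hd' r (by omega)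
  rw [Function.comp_apply, h' (f y) hy₂, hy₁, zpow_add₀ two_ne_zero]
  ring

theorem IsDyadicPL.inv {g : Equiv.Perm UnitIco} (hg : IsDyadicPL g) : IsDyadicPL (g⁻¹ : _) := by
  obtain ⟨n, M, hn⟩ := hg.exists_level
  refine isDyadicPL_of_level (n + M) fun x => ?_
  obtain ⟨k, d, hk, hd, hd', h⟩ := hn (g⁻¹ x)
  have hk' := abs_le.1 hk
  refine ⟨-k, -(2 ^ (-k) * d), ((IsDyadic.zpow _).mul hd).neg, fun y hy => ?_⟩
  have h2 : (0 : ℝ) < 2 ^ n := by positivity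
  have hkk : (2 : ℝ) ^ k * 2 ^ (-k) = 1 := by rw [← zpow_add₀ two_ne_zero]; simp
  have hx : (2 : ℝ) ^ (-k) * (x : ℝ) + -(2 ^ (-k) * d) = (g⁻¹ x : UnitIco) := by
    have := h (g⁻¹ x) rfl
    rw [show g (g⁻¹ x) = x from g.apply_symm_apply x] at this
    rw [this]
    linear_combination ((g⁻¹ x : UnitIco) : ℝ) * hkk
  have hz : ⌊2 ^ n * ((2 : ℝ) ^ (-k) * (y : ℝ) + -(2 ^ (-k) * d))⌋ =
      ⌊2 ^ n * ((g⁻¹ x : UnitIco) : ℝ)⌋ := by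
    rw [← hx]
    refine floor_affine (by push_cast; omega) ?_ hy
    obtain ⟨p, hp⟩ := hd' (n + M) (by omega)
    refine ⟨-p, ?_⟩
    rw [zpow_sub₀ two_ne_zero, zpow_natCast]
    push_cast
    rw [← hp, zpow_neg]
    field_simp
  have hz0 : 0 ≤ (2 : ℝ) ^ (-k) * (y : ℝ) + -(2 ^ (-k) * d) := by
    have : 0 ≤ ⌊2 ^ n * ((2 : ℝ) ^ (-k) * (y : ℝ) + -(2 ^ (-k) * d))⌋ := by
      rw [hz]
      exact Int.floor_nonneg.2 (mul_nonneg h2.le (g⁻¹ x).2.1)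
    exact (mul_nonneg_iff_of_pos_left h2).1 (Int.floor_nonneg.1 this)
  have hz1 : (2 : ℝ) ^ (-k) * (y : ℝ) + -(2 ^ (-k) * d) < 1 := by
    have : ⌊2 ^ n * ((2 : ℝ) ^ (-k) * (y : ℝ) + -(2 ^ (-k) * d))⌋ < ((2 ^ n : ℕ) : ℤ) := by
      rw [hz, Int.floor_lt]
      push_cast
      nlinarith [(g⁻¹ x).2.2]
    rw [Int.floor_lt] at this
    push_cast at this
    nlinarith
  have hgz := h ⟨_, hz0, hz1⟩ hz
  have : g ⟨_, hz0, hz1⟩ = y := by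
    apply Subtype.ext
    rw [hgz]
    linear_combination ((y : ℝ) - d) * hkk
  have e : g⁻¹ y = ⟨_, hz0, hz1⟩ := by
    exact (Equiv.symm_apply_eq g).2 this.symm
  rw [e]

/-- Thompson's group `V`: the group of all dyadic piecewise linear bijections of `[0, 1)`.
The product is composition of maps, `(f * g) x = f (g x)`. -/
def thompsonV : Subgroup (Equiv.Perm UnitIco) where
  carrier := {g | IsDyadicPL g}
  mul_mem' hf hg := hf.comp hg
  one_mem' := ⟨0, fun _ => ⟨0, 0, ⟨0, 0, by simp⟩, fun x _ _ => by simp⟩⟩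
  inv_mem' hg := hg.inv

/-- The map attached to the associativity operator: it maps the dyadic partition of `[0,1)` given
by the leaves of the image `(t₁t₂)t₃` to the one given by `t₁(t₂t₃)`, that is, `[0,1/4)` to
`[0,1/2)`, `[1/4,1/2)` to `[1/2,3/4)` and `[1/2,1)` to `[3/4,1)`, affinely. (The orientation from
image to source makes the product of operators, first `f`, then `g`, correspond to the composition
`f ∘ g` of maps.) -/
noncomputable def permA : Equiv.Perm UnitIco where
  toFun x :=
    ⟨if (x : ℝ) < 1 / 4 then 2 * x else if (x : ℝ) < 1 / 2 then x + 1 / 4 else (x + 1) / 2, by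
      have h₀ := x.2.1
      have h₁ := x.2.2
      constructor <;> split_ifs <;> linarith⟩
  invFun x :=
    ⟨if (x : ℝ) < 1 / 2 then x / 2 else if (x : ℝ) < 3 / 4 then x - 1 / 4 else 2 * x - 1, by
      have h₀ := x.2.1
      have h₁ := x.2.2
      constructor <;> split_ifs <;> linarith⟩
  left_inv x := by
    apply Subtype.ext
    dsimp only
    split_ifs <;> linarith
  right_inv x := by
    apply Subtype.ext
    dsimp only
    split_ifs <;> linarith

/-- The map that exchanges `[0,1/2)` and `[1/2,1)` by translations. -/
noncomputable def permC : Equiv.Perm UnitIco where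
  toFun x :=
    ⟨if (x : ℝ) < 1 / 2 then x + 1 / 2 else x - 1 / 2, by
      have h₀ := x.2.1
      have h₁ := x.2.2
      constructor <;> split_ifs <;> linarith⟩
  invFun x :=
    ⟨if (x : ℝ) < 1 / 2 then x + 1 / 2 else x - 1 / 2, by
      have h₀ := x.2.1
      have h₁ := x.2.2
      constructor <;> split_ifs <;> linarith⟩
  left_inv x := by
    have h₀ := x.2.1
    have h₁ := x.2.2
    apply Subtype.ext
    dsimp only
    split_ifs <;> linarith
  right_inv x := by
    have h₀ := x.2.1
    have h₁ := x.2.2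
    apply Subtype.ext
    dsimp only
    split_ifs <;> linarith

/-- The underlying function of `permRight`: the identity on `[0,1/2)`, and the conjugate of `g` by
the increasing affine map `[0,1) → [1/2,1)` on `[1/2,1)`. -/
noncomputable def rightFun (g : UnitIco → UnitIco) (x : UnitIco) : UnitIco :=
  if h : (x : ℝ) < 1 / 2 then x
  else
    let y : UnitIco := g ⟨2 * x - 1, by linarith, by linarith [x.2.2]⟩
    ⟨(1 + y) / 2, by linarith [y.2.1], by linarith [y.2.2]⟩

theorem rightFun_comp {g f : UnitIco → UnitIco} (h : Function.LeftInverse g f) (x : UnitIco) :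
    rightFun g (rightFun f x) = x := by
  by_cases hx : (x : ℝ) < 1 / 2
  · have e : rightFun f x = x := by rw [rightFun, dif_pos hx]
    rw [e, rightFun, dif_pos hx]
  · have hy : ¬ ((rightFun f x : UnitIco) : ℝ) < 1 / 2 := by
      rw [rightFun, dif_neg hx]
      have := (f ⟨2 * x - 1, by linarith, by linarith [x.2.2]⟩).2.1
      simp only [not_lt]
      linarith
    apply Subtype.ext
    rw [rightFun, dif_neg hy]
    dsimp only
    have e : (⟨2 * (rightFun f x : UnitIco) - 1, by linarith,
        by linarith [(rightFun f x).2.2]⟩ : UnitIco) =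
        f ⟨2 * x - 1, by linarith, by linarith [x.2.2]⟩ := by
      apply Subtype.ext
      dsimp only
      rw [rightFun, dif_neg hx]
      dsimp only
      ring
    rw [e, h]
    dsimp only
    ring

/-- Letting `g` act on the right half `[1/2,1)` of `[0,1)`. -/
noncomputable def permRight (g : Equiv.Perm UnitIco) : Equiv.Perm UnitIco where
  toFun := rightFun g
  invFun := rightFun g.symm
  left_inv := rightFun_comp g.left_inv
  right_inv := rightFun_comp g.right_inv

theorem permA_mem : permA ∈ thompsonV := by
  refine ⟨2, fun j => ?_⟩
  have e : ∀ x : UnitIco, ((permA x : UnitIco) : ℝ) = if (x : ℝ) < 1 / 4 then 2 * (x : ℝ) else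
    if (x : ℝ) < 1 / 2 then (x : ℝ) + 1 / 4 else ((x : ℝ) + 1) / 2 := fun _ => rfl
  simp only [e]
  fin_cases j
  · refine ⟨1, 0, ⟨0, 0, by simp⟩, fun x _ h => ?_⟩
    norm_num at h
    rw [if_pos (by linarith)]; simp
  · refine ⟨0, 1 / 4, ⟨1, 2, by norm_num⟩, fun x h h' => ?_⟩
    norm_num at h h'
    rw [if_neg (by linarith), if_pos (by linarith)]; simp
  · refine ⟨-1, 1 / 2, ⟨1, 1, by norm_num⟩, fun x h h' => ?_⟩
    norm_num at h h'
    rw [if_neg (by linarith), if_neg (by linarith), zpow_neg_one]; ring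
  · refine ⟨-1, 1 / 2, ⟨1, 1, by norm_num⟩, fun x h h' => ?_⟩
    norm_num at h h'
    rw [if_neg (by linarith), if_neg (by linarith), zpow_neg_one]; ring

theorem permC_mem : permC ∈ thompsonV := by
  refine ⟨1, fun j => ?_⟩
  have e : ∀ x : UnitIco, ((permC x : UnitIco) : ℝ) = if (x : ℝ) < 1 / 2 then (x : ℝ) + 1 / 2
    else (x : ℝ) - 1 / 2 := fun _ => rfl
  simp only [e]
  fin_cases j
  · refine ⟨0, 1 / 2, ⟨1, 1, by norm_num⟩, fun x h h' => ?_⟩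
    norm_num at h'
    rw [if_pos (by linarith)]; simp
  · refine ⟨0, -1 / 2, ⟨-1, 1, by norm_num⟩, fun x h h' => ?_⟩
    norm_num at h
    rw [if_neg (by linarith)]; simp; ring

theorem permRight_mem {g : Equiv.Perm UnitIco} (hg : g ∈ thompsonV) :
    permRight g ∈ thompsonV := by
  obtain ⟨n, M, hn⟩ := IsDyadicPL.exists_level hg
  refine isDyadicPL_of_level (n + 1) fun x => ?_
  have half : ∀ y : UnitIco, ⌊2 ^ (n + 1) * (y : ℝ)⌋ = ⌊2 ^ (n + 1) * (x : ℝ)⌋ →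
      ((y : ℝ) < 1 / 2 ↔ (x : ℝ) < 1 / 2) := by
    intro y hy
    have h1 := floor_coarsen (n := 1) (by omega) hy
    have e : ∀ z : ℝ, z < 1 / 2 ↔ ⌊2 ^ 1 * z⌋ < 1 := by
      intro z
      rw [Int.floor_lt]
      push_cast
      constructor <;> intro h <;> linarith
    rw [e, e, h1]
  by_cases hx : (x : ℝ) < 1 / 2
  · refine ⟨0, 0, ⟨0, 0, by simp⟩, fun y hy => ?_⟩
    change ((rightFun g y : UnitIco) : ℝ) = _
    rw [rightFun, dif_pos ((half y hy).2 hx)]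
    simp
  · obtain ⟨k, d, -, hd, -, h⟩ := hn ⟨2 * x - 1, by linarith, by linarith [x.2.2]⟩
    refine ⟨k, 2 ^ (-1 : ℤ) * (((1 : ℤ) : ℝ) + -2 ^ k + d),
      (IsDyadic.zpow _).mul (((IsDyadic.intCast 1).add (IsDyadic.zpow k).neg).add hd),
      fun y hy => ?_⟩
    have hy' : ¬ (y : ℝ) < 1 / 2 := by rwa [half y hy]
    change ((rightFun g y : UnitIco) : ℝ) = _
    rw [rightFun, dif_neg hy']
    dsimp only
    rw [h ⟨2 * y - 1, by linarith, by linarith [y.2.2]⟩ ?_]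
    · rw [zpow_neg_one]
      push_cast
      ring
    · dsimp only
      have e : ∀ z : ℝ, (2 : ℝ) ^ n * (2 * z - 1) = 2 ^ (n + 1) * z - ((2 ^ n : ℤ) : ℝ) := by
        intro z
        push_cast
        ring
      rw [e, e, Int.floor_sub_intCast, Int.floor_sub_intCast, hy]

/-- The map attached to a kind of letter. -/
noncomputable def basePerm : Letter → Equiv.Perm UnitIco
  | .a => permA
  | .c => permC

theorem iterate_permRight_mem (x : Letter) (i : ℕ) : permRight^[i] (basePerm x) ∈ thompsonV := by
  induction i with
  | zero => cases x; exacts [permA_mem, permC_mem]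
  | succ i ih =>
    rw [Function.iterate_succ_apply']
    exact permRight_mem ih

/-- The elements `a₁, a₂, …` and `c₁, c₂, …` of `V`: `a_{i+1}` and `c_{i+1}` are the identity on
`[0, 1 - 1/2^i)`, and rescaled copies of `permA` and `permC` on `[1 - 1/2^i, 1)`. -/
noncomputable def thompsonGen (g : Gen) : thompsonV :=
  ⟨permRight^[g.2] (basePerm g.1), iterate_permRight_mem g.1 g.2⟩

end ACGeometry

/-!
Both groups are images of the group `G` presented by the relations, and the two evaluation maps are
compared through their action on trees.

*Soundness.* Each relator, read as an operator, fixes every tree on which it is defined, so it is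
trivial in the geometry group (`lift_geomGen_relator`). The leaves of a tree cut `[0,1)` into
standard dyadic intervals, and an operator that maps `t` to `t'` is described by the permutation of
`[0,1)` that sends the interval of each leaf of `t'` affinely to the interval of the same leaf of
`t` (`describes_wordOp`). Since a tree with distinct colours has an injective location map, a word
that is trivial in the geometry group is trivial in `V` (`ker_lift_geomGen_le`).

*Completeness.* The relations allow one to define in `G`, for every tree `t`, an element
`normalizer t` which transforms `t` into the right comb with the same leaves in increasing order:
first all left subtrees are unfolded into the right spine (`toComb`), then the leaves of the comb
are sorted by insertion (`combSort`), with the transpositions `c_i a_i⁻¹ c_{i+1}⁻¹` and, for the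
last two leaves, `c_i`. These satisfy the Coxeter relations of a symmetric group as a consequence of the
relations (`isCoxeterA_combSwap`). The key fact, `normalizer_eq`, is that if the operator of a
generator `x` maps `t` to `t'`, then `normalizer t = x * normalizer t'` in `G`. For `a_i` this is
the definition of unfolding, and for `c_i` it says that block transpositions are natural with
respect to unfolding (`unfold_swap`, `toCombSwap`), in the spirit of Mac Lane's coherence theorem.
Now a word `w` that is trivial in `V` maps some tree `t` with distinct colours to a tree with the
same location map, that is, to `t` itself; hence `normalizer t = w * normalizer t`, and `w = 1` in
`G` (`ker_lift_thompsonGen_le`).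

*Generation.* An operator that acts in a left subtree is conjugate by a `C` to one that acts in a
right subtree, so the spine operators generate the geometry group. For `V`, a dyadic piecewise
linear bijection carries the leaf intervals of a complete tree to those of another tree
(`exists_locate_eq_comp_inv`), and two trees with the same leaves up to order are connected by
associativity and commutativity (`ACEquiv.of_perm`).
-/

namespace ACGeometry

/-! ### Consequences of the relations in an arbitrary group -/

section Algebra

variable {G : Type*} [Group G]

/-- The word `c_i a_i⁻¹ c_{i+1}⁻¹`. As an operator on trees, it exchanges `t₁` and `t₂` in the
subtree `t₁(t₂t₃)` at the address `1^i`. -/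
def tau (a c : ℕ → G) (i : ℕ) : G := c i * (a i)⁻¹ * (c (i + 1))⁻¹

/-- The sequences `a` and `c` satisfy the relations `RacRel` in the group `G`. Only one of the two
pentagon relations is kept, since they coincide when `c_i² = 1`. -/
structure IsRacPair (a c : ℕ → G) : Prop where
  a_mul_a : ∀ {i j}, i < j → a i * a j = a (j + 1) * a i
  a_mul_c : ∀ {i j}, i < j → a i * c j = c (j + 1) * a i
  tau_comm_a : ∀ {i j}, i + 2 ≤ j → Commute (tau a c i) (a j)
  tau_comm_c : ∀ {i j}, i + 2 ≤ j → Commute (tau a c i) (c j)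
  pentagon : ∀ i, a (i + 1) * a i * c i * a (i + 1) = a i ^ 2 * c i
  hexagon : ∀ i, a i * c i * c (i + 1) * a i = c (i + 1) * c i
  hexagon₂ : ∀ i, c (i + 1) * c i * (a i)⁻¹ * c (i + 1) = c i * (a i)⁻¹ * c i * (a i)⁻¹
  c_mul_c : ∀ i, c i * c i = 1

namespace IsRacPair

variable {a c : ℕ → G} (h : IsRacPair a c)
include h

theorem c_inv (i : ℕ) : (c i)⁻¹ = c i := inv_eq_of_mul_eq_one_left (h.c_mul_c i)

theorem c_mul_c_mul (i : ℕ) (x : G) : c i * (c i * x) = x := by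
  rw [← mul_assoc, h.c_mul_c, one_mul]

/-- The rotation `c_i a_i⁻¹`, which maps `t₁(t₂t₃)` to `t₂(t₃t₁)`, is inverted by `c_{i+1}`. -/
theorem c_conj_rot (i : ℕ) :
    c (i + 1) * (c i * (a i)⁻¹) * c (i + 1) = c i * (a i)⁻¹ * (c i * (a i)⁻¹) := by
  simpa [mul_assoc] using h.hexagon₂ i

/-- Conjugating twice by `c_{i+1}` shows that the rotation `z` satisfies `z = z⁴`. -/
theorem rot_pow_three (i : ℕ) :
    c i * (a i)⁻¹ * (c i * (a i)⁻¹) * (c i * (a i)⁻¹) = 1 := by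
  have e := h.c_conj_rot i
  have hc := h.c_mul_c (i + 1)
  set z := c i * (a i)⁻¹
  set d := c (i + 1)
  have h₁ : z = d * (z * z) * d := by
    rw [← e]
    calc z = d * d * z * (d * d) := by rw [hc]; simp
      _ = _ := by simp only [mul_assoc]
  have h₂ : d * (z * z) * d = d * z * d * (d * z * d) := by
    calc d * (z * z) * d = d * z * 1 * z * d := by simp only [mul_assoc, one_mul]
      _ = _ := by rw [← hc]; simp only [mul_assoc]
  rw [h₂, e] at h₁
  have h₃ : z * (z * z * z) = z * 1 := by
    rw [mul_one]; nth_rw 5 [h₁]; simp only [mul_assoc]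
  exact mul_left_cancel h₃

theorem tau_eq (i : ℕ) : tau a c i = c i * (a i)⁻¹ * c (i + 1) := by
  rw [tau, h.c_inv]

omit h in
theorem tau_mul_c (i : ℕ) : tau a c i * c (i + 1) = c i * (a i)⁻¹ := by
  rw [tau, inv_mul_cancel_right]

theorem tau_mul_tau (i : ℕ) : tau a c i * tau a c i = 1 := by
  have e := h.c_conj_rot i
  have e' := h.rot_pow_three i
  rw [h.tau_eq]
  calc _ = c i * (a i)⁻¹ * (c (i + 1) * (c i * (a i)⁻¹) * c (i + 1)) := by simp only [mul_assoc]
    _ = 1 := by rw [e, ← mul_assoc, e']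

theorem tau_c_braid (i : ℕ) :
    tau a c i * c (i + 1) * tau a c i = c (i + 1) * tau a c i * c (i + 1) := by
  rw [mul_assoc (c _), tau_mul_c]
  have e := h.c_conj_rot i
  rw [h.tau_eq, ← mul_assoc, ← e, mul_assoc _ (c (i + 1)), h.c_mul_c, mul_one]

/-- A transposition of the two factors of `(t₁t₂)t₃` decomposes into two transpositions of
consecutive factors. -/
theorem c_eq (i : ℕ) : c i = (a i)⁻¹ * c (i + 1) * tau a c i := by
  have e := h.hexagon i
  calc c i = (a i)⁻¹ * (a i * c i * c (i + 1) * a i) * (a i)⁻¹ * (c (i + 1))⁻¹ := by group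
    _ = _ := by rw [e, tau]; group

theorem a_inv_mul_a {i j : ℕ} (hij : i < j) : a j * (a i)⁻¹ = (a i)⁻¹ * a (j + 1) := by
  rw [mul_inv_eq_iff_eq_mul, mul_assoc, ← h.a_mul_a hij, inv_mul_cancel_left]

theorem a_inv_mul_c {i j : ℕ} (hij : i < j) : c j * (a i)⁻¹ = (a i)⁻¹ * c (j + 1) := by
  rw [mul_inv_eq_iff_eq_mul, mul_assoc, ← h.a_mul_c hij, inv_mul_cancel_left]

theorem a_mul_tau {i j : ℕ} (hij : i < j) : a i * tau a c j = tau a c (j + 1) * a i := by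
  have h₁ : SemiconjBy (a i) (a j) (a (j + 1)) := h.a_mul_a hij
  have h₂ : SemiconjBy (a i) (c j) (c (j + 1)) := h.a_mul_c hij
  have h₃ : SemiconjBy (a i) (c (j + 1)) (c (j + 1 + 1)) := h.a_mul_c (by omega)
  exact (h₂.mul_right h₁.inv_right).mul_right h₃.inv_right

theorem tau_mul_a_inv {i j : ℕ} (hij : i < j) :
    tau a c j * (a i)⁻¹ = (a i)⁻¹ * tau a c (j + 1) := by
  rw [mul_inv_eq_iff_eq_mul, mul_assoc, ← h.a_mul_tau hij, inv_mul_cancel_left]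

theorem tau_comm_tau {i j : ℕ} (hij : i + 2 ≤ j) : Commute (tau a c i) (tau a c j) :=
  ((h.tau_comm_c hij).mul_right (h.tau_comm_a hij).inv_right).mul_right
    (h.tau_comm_c (by omega)).inv_right

/-- Naturality of the transposition of `t₁` and `t₂`, when `t₂` is split. -/
theorem tau_mul_a_inv_self (i : ℕ) :
    tau a c i * (a i)⁻¹ = (a (i + 1))⁻¹ * tau a c i * tau a c (i + 1) := by
  have e := congrArg (·⁻¹) (h.pentagon i)
  simp only [mul_inv_rev, h.c_inv] at e
  have e₁ : (a (i + 1))⁻¹ * tau a c i * tau a c (i + 1) =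
      (a (i + 1))⁻¹ * (c i * ((a i)⁻¹ * (a (i + 1))⁻¹)) * c (i + 2) := by
    rw [h.tau_eq, h.tau_eq]
    simp only [mul_assoc, h.c_mul_c_mul]
  rw [e₁, e, h.tau_eq, mul_assoc, mul_assoc, h.a_inv_mul_c (by omega)]
  simp only [mul_assoc, pow_two, mul_inv_rev]

/-- Naturality of the transposition of `t₁` and `t₂`, when `t₁` is split. -/
theorem tau_mul_a_inv_succ (i : ℕ) :
    tau a c i * (a (i + 1))⁻¹ = (a i)⁻¹ * tau a c (i + 1) * tau a c i := by
  have e := h.tau_mul_a_inv_self i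
  have hi : ∀ j, (tau a c j)⁻¹ = tau a c j := fun j => inv_eq_of_mul_eq_one_left (h.tau_mul_tau j)
  calc _ = (a i)⁻¹ * (tau a c i * (a i)⁻¹)⁻¹ * (a (i + 1))⁻¹ := by
        rw [mul_inv_rev, hi]; group
    _ = _ := by rw [e]; simp only [mul_inv_rev, hi]; group

/-- The braid relation follows from the one between `tau i` and `c (i + 1)`, by writing `c (i + 1)`
as the transposition of a tree with a split left factor. -/
theorem tau_braid (i : ℕ) : tau a c i * tau a c (i + 1) * tau a c i =
    tau a c (i + 1) * tau a c i * tau a c (i + 1) := by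
  have e := h.tau_c_braid i
  have comm : tau a c i * c (i + 2) = c (i + 2) * tau a c i := h.tau_comm_c le_rfl
  have left : tau a c i * c (i + 1) * tau a c i =
      (a i)⁻¹ * (tau a c (i + 1) * (c (i + 2) * (tau a c i * tau a c (i + 1) * tau a c i))) := by
    rw [h.c_eq (i + 1)]
    calc _ = tau a c i * (a (i + 1))⁻¹ * c (i + 2) * tau a c (i + 1) * tau a c i := by
          simp only [mul_assoc]
      _ = (a i)⁻¹ * tau a c (i + 1) * (tau a c i * c (i + 2)) * tau a c (i + 1) * tau a c i := by
          rw [h.tau_mul_a_inv_succ]; simp only [mul_assoc]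
      _ = _ := by rw [comm]; simp only [mul_assoc]
  have right : c (i + 1) * tau a c i * c (i + 1) =
      (a i)⁻¹ * (tau a c (i + 1) * (c (i + 2) * (tau a c (i + 1) * tau a c i *
        tau a c (i + 1)))) := by
    have e₂ := h.tau_c_braid (i + 1)
    calc _ = (c (i + 1) * (tau a c i * (a (i + 1))⁻¹)) * c (i + 2) * tau a c (i + 1) := by
          nth_rw 2 [h.c_eq (i + 1)]; simp only [mul_assoc]
      _ = (c (i + 1) * (a i)⁻¹) * (tau a c (i + 1) * (tau a c i * c (i + 2)) *
            tau a c (i + 1)) := by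
          rw [h.tau_mul_a_inv_succ]; simp only [mul_assoc]
      _ = (a i)⁻¹ * ((c (i + 2) * tau a c (i + 1) * c (i + 2)) * tau a c i *
            tau a c (i + 1)) := by
          rw [h.a_inv_mul_c (by omega), comm]; simp only [mul_assoc]
      _ = _ := by rw [← e₂]; simp only [mul_assoc]
  rw [left, right] at e
  exact mul_left_cancel (mul_left_cancel (mul_left_cancel e))

end IsRacPair
end Algebra

/-! ### Sorting with Coxeter generators -/

section Sorting

variable {M : Type*} [Group M]

/-- The product `s_k s_{k+1} ⋯ s_{k+p-1}`, which moves the `k`-th entry of a list past the next `p`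
ones. -/
def slide (s : ℕ → M) : ℕ → ℕ → M
  | _, 0 => 1
  | k, p + 1 => s k * slide s (k + 1) p

/-- The product of transpositions performed by insertion sort on a list whose entries are numbered
from `k` on. -/
def sortWord (s : ℕ → M) : ℕ → List ℕ+ → M
  | _, [] => 1
  | k, x :: l => sortWord s (k + 1) l * slide s k (l.countP (· < x))

/-- The relations of type `A` between `s₀, …, s_{n-2}`, for permutations of `n` entries. -/
structure IsCoxeterA (s : ℕ → M) (n : ℕ) : Prop where
  sq : ∀ {i}, i + 1 < n → s i * s i = 1
  braid : ∀ {i}, i + 2 < n → s i * s (i + 1) * s i = s (i + 1) * s i * s (i + 1)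
  comm : ∀ {i j}, i + 2 ≤ j → j + 1 < n → Commute (s i) (s j)

namespace IsCoxeterA

variable {s : ℕ → M} {n : ℕ} (h : IsCoxeterA s n)
include h

theorem commute_slide {i k p : ℕ} (hi : i + 2 ≤ k) (hp : k + p < n) :
    Commute (s i) (slide s k p) := by
  induction p generalizing k with
  | zero => exact Commute.one_right _
  | succ p ih => exact (h.comm hi (by omega)).mul_right (ih (by omega) (by omega))

theorem commute_sortWord {i k : ℕ} {l : List ℕ+} (hi : i + 2 ≤ k) (hl : k + l.length ≤ n) :
    Commute (s i) (sortWord s k l) := by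
  induction l generalizing k with
  | nil => exact Commute.one_right _
  | cons x l ih =>
    simp only [List.length_cons] at hl
    have := List.countP_le_length (p := (· < x)) (l := l)
    exact (ih (by omega) (by omega)).mul_right (h.commute_slide hi (by omega))

theorem slide_mul {k i p : ℕ} (hki : k ≤ i) (hi : i + 1 < k + p) (hp : k + p < n) :
    slide s k p * s i = s (i + 1) * slide s k p := by
  induction p generalizing k with
  | zero => omega
  | succ p ih =>
    rcases hki.eq_or_lt with rfl | hki
    · cases p with
      | zero => omega
      | succ p =>
        have e : Commute (s k) (slide s (k + 1 + 1) p) := h.commute_slide (by omega) (by omega)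
        have b := h.braid (i := k) (by omega)
        calc _ = s k * s (k + 1) * (slide s (k + 1 + 1) p * s k) := by simp only [slide, mul_assoc]
          _ = s k * s (k + 1) * s k * slide s (k + 1 + 1) p := by rw [← e.eq, mul_assoc _ (s k)]
          _ = _ := by rw [b]; simp only [slide, mul_assoc]
    · have e : Commute (s k) (s (i + 1)) := h.comm (by omega) (by omega)
      rw [slide, mul_assoc, ih (by omega) (by omega) (by omega), ← mul_assoc, e.eq, mul_assoc]

theorem slide_mul_slide {k p q : ℕ} (hpq : p ≤ q) (hq : k + (q + 1) < n) :
    slide s k (q + 1) * slide s k p = slide s (k + 1) p * slide s k (q + 1) := by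
  suffices ∀ i, k ≤ i → i + p ≤ k + q →
      slide s k (q + 1) * slide s i p = slide s (i + 1) p * slide s k (q + 1) from
    this k le_rfl (by omega)
  clear hpq
  induction p with
  | zero => intros; simp [slide]
  | succ p ih =>
    intro i hi hip
    calc _ = slide s k (q + 1) * s i * slide s (i + 1) p := (mul_assoc _ _ _).symm
      _ = s (i + 1) * slide s (i + 1 + 1) p * slide s k (q + 1) := by
        rw [h.slide_mul hi (by omega) (by omega), mul_assoc, ih (i + 1) (by omega) (by omega),
          mul_assoc]

theorem mul_sortWord_head {k : ℕ} {x y : ℕ+} {l : List ℕ+} (hxy : x ≠ y)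
    (hl : k + (l.length + 2) ≤ n) :
    s k * sortWord s k (x :: y :: l) = sortWord s k (y :: x :: l) := by
  have key : ∀ {x y : ℕ+}, x < y →
      s k * sortWord s k (x :: y :: l) = sortWord s k (y :: x :: l) := by
    intro x y hxy
    have h₁ : l.countP (· < x) ≤ l.countP (· < y) :=
      List.countP_mono_left fun z _ hz => by simpa using (by simpa using hz : z < x).trans hxy
    have h₂ := List.countP_le_length (p := (· < y)) (l := l)
    have e : Commute (s k) (sortWord s (k + 1 + 1) l) := h.commute_sortWord le_rfl (by omega)
    have e₁ : (y :: l).countP (· < x) = l.countP (· < x) :=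
      List.countP_cons_of_neg (by simpa using hxy.le)
    have e₂ : (x :: l).countP (· < y) = l.countP (· < y) + 1 :=
      List.countP_cons_of_pos (by simpa using hxy)
    simp only [sortWord, e₁, e₂]
    rw [mul_assoc, mul_assoc, ← h.slide_mul_slide h₁ (by omega), slide, ← mul_assoc, e.eq]
    simp only [mul_assoc]
  rcases lt_or_gt_of_ne hxy with hlt | hlt
  · exact key hlt
  · rw [← key hlt, ← mul_assoc, h.sq (by omega), one_mul]

/-- Exchanging two consecutive entries multiplies the sorting word by the corresponding
generator. -/
theorem sortWord_swap {p q : List ℕ+} {x y : ℕ+} (hxy : x ≠ y)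
    (hn : p.length + (q.length + 2) = n) :
    sortWord s 0 (p ++ x :: y :: q) = s p.length * sortWord s 0 (p ++ y :: x :: q) := by
  suffices ∀ k, k + p.length + (q.length + 2) = n →
      sortWord s k (p ++ x :: y :: q) = s (k + p.length) * sortWord s k (p ++ y :: x :: q) by
    simpa using this 0 (by omega)
  clear hn
  induction p with
  | nil => intro k hk; exact (h.mul_sortWord_head hxy.symm (by simpa using hk.le)).symm
  | cons z p ih =>
    intro k hk
    simp only [List.length_cons] at hk
    have e : (p ++ x :: y :: q).countP (· < z) = (p ++ y :: x :: q).countP (· < z) :=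
      ((List.Perm.swap y x q).append_left p).countP_eq _
    simp only [List.cons_append, sortWord, List.length_cons]
    rw [ih (k + 1) (by omega), e, mul_assoc]
    congr 2
    omega

end IsCoxeterA
end Sorting

/-! ### The normalizing element of a tree -/

namespace CTree

/-- The colours of the leaves, from left to right. -/
def leaves : CTree → List ℕ+
  | leaf x => [x]
  | node l r => l.leaves ++ r.leaves

theorem leaves_length_pos (t : CTree) : 0 < t.leaves.length := by
  induction t with
  | leaf x => simp [leaves]
  | node l r ihl ihr => simp only [leaves, List.length_append]; omega

end CTree

section Normalize

variable {G : Type*} [Group G]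

/-- The element that unfolds the subtree `t` at the address `1^i 0` into the spine: it maps
`t r` to `x₁(x₂(⋯(x_n r)))`, where `x₁, …, x_n` are the leaves of `t`. -/
def unfold (a : ℕ → G) : CTree → ℕ → G
  | .leaf _, _ => 1
  | .node l r, i => (a i)⁻¹ * unfold a l i * unfold a r (i + l.leaves.length)

/-- The element that maps the subtree `t` at the address `1^i` to the right comb with the same
leaves in the same order. -/
def toComb (a : ℕ → G) : CTree → ℕ → G
  | .leaf _, _ => 1
  | .node l r, i => unfold a l i * toComb a r (i + l.leaves.length)

/-- The transpositions of consecutive leaves of the right comb with `n` leaves. -/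
def combSwap (a c : ℕ → G) (n i : ℕ) : G := if i + 2 < n then tau a c i else c i

/-- The element that sorts the leaves of the right comb whose list of leaves is `l`. -/
def combSort (a c : ℕ → G) (l : List ℕ+) : G := sortWord (combSwap a c l.length) 0 l

/-- The element that maps the tree `t` to the right comb with the same leaves, in increasing
order. -/
def normalizer (a c : ℕ → G) (t : CTree) : G := toComb a t 0 * combSort a c t.leaves

namespace IsRacPair

variable {a c : ℕ → G} (h : IsRacPair a c)
include h

theorem isCoxeterA_combSwap (n : ℕ) : IsCoxeterA (combSwap a c n) n where
  sq {i} hi := by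
    unfold combSwap; split_ifs
    exacts [h.tau_mul_tau i, h.c_mul_c i]
  braid {i} hi := by
    unfold combSwap
    rw [if_pos hi]; split_ifs
    exacts [h.tau_braid i, h.tau_c_braid i]
  comm {i j} hij hj := by
    unfold combSwap
    rw [if_pos (by omega)]; split_ifs
    exacts [h.tau_comm_tau hij, h.tau_comm_c hij]

theorem combSort_swap {p q : List ℕ+} {x y : ℕ+} (hq : q ≠ []) (hxy : x ≠ y) :
    combSort a c (p ++ x :: y :: q) = tau a c p.length * combSort a c (p ++ y :: x :: q) := by
  have hq := List.length_pos_of_ne_nil hq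
  have e : (p ++ x :: y :: q).length = (p ++ y :: x :: q).length := by simp
  rw [combSort, combSort, e, (h.isCoxeterA_combSwap _).sortWord_swap hxy (by simp)]
  congr 1
  rw [combSwap, if_pos]
  simp only [List.length_append, List.length_cons]; omega

theorem combSort_swap_last {p : List ℕ+} {x y : ℕ+} (hxy : x ≠ y) :
    combSort a c (p ++ [x, y]) = c p.length * combSort a c (p ++ [y, x]) := by
  have e : (p ++ [x, y]).length = (p ++ [y, x]).length := by simp
  rw [combSort, combSort, e, (h.isCoxeterA_combSwap _).sortWord_swap hxy (by simp)]
  congr 1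
  rw [combSwap, if_neg (by simp)]

omit h in
/-- Moving a letter past the unfolding of a subtree with `n` leaves decreases its index by
`n - 1`. -/
theorem mul_unfold {x : ℕ → G}
    (hx : ∀ {i j}, i < j → x j * (a i)⁻¹ = (a i)⁻¹ * x (j + 1)) (t : CTree) {i j : ℕ}
    (hij : i ≤ j) : x (j + 1) * unfold a t i = unfold a t i * x (j + t.leaves.length) := by
  induction t generalizing i j with
  | leaf y => simp [unfold, CTree.leaves]
  | node u v ihu ihv =>
    simp only [unfold, CTree.leaves, List.length_append]
    calc _ = x (j + 1) * (a i)⁻¹ * unfold a u i * unfold a v (i + u.leaves.length) := by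
          simp only [mul_assoc]
      _ = (a i)⁻¹ * (x (j + 1 + 1) * unfold a u i) * unfold a v (i + u.leaves.length) := by
          rw [hx (by omega)]; simp only [mul_assoc]
      _ = (a i)⁻¹ * unfold a u i *
            (x (j + u.leaves.length + 1) * unfold a v (i + u.leaves.length)) := by
          rw [ihu (by omega), add_right_comm]; simp only [mul_assoc]
      _ = _ := by rw [ihv (by omega), add_assoc j]; simp only [mul_assoc]

theorem tau_commute_unfold (t : CTree) {i m : ℕ} (him : i + 2 ≤ m) :
    Commute (tau a c i) (unfold a t m) := by
  induction t generalizing m with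
  | leaf y => exact Commute.one_right _
  | node u v ihu ihv =>
    exact ((h.tau_comm_a him).inv_right.mul_right (ihu him)).mul_right (ihv (by omega))

theorem tau_commute_toComb (t : CTree) {i m : ℕ} (him : i + 2 ≤ m) :
    Commute (tau a c i) (toComb a t m) := by
  induction t generalizing m with
  | leaf y => exact Commute.one_right _
  | node u v ihu ihv => exact (h.tau_commute_unfold u him).mul_right (ihv (by omega))

/-- The special case of `unfold_swap` where the left one of the two trees is a leaf. -/
theorem unfold_swap_leaf (r : CTree) {m : ℕ} {p q : List ℕ+} {x : ℕ+} {g : G}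
    (hp : p.length = m) (hq : q ≠ []) (hn : (p ++ x :: (r.leaves ++ q)).Nodup)
    (hg : ∀ j, m ≤ j → j < m + r.leaves.length → Commute (tau a c j) g) :
    unfold a r (m + 1) * g * combSort a c (p ++ x :: (r.leaves ++ q)) =
      tau a c m * unfold a r m * g * combSort a c (p ++ (r.leaves ++ x :: q)) := by
  induction r generalizing m p q x g with
  | leaf y =>
    have hxy : x ≠ y := by
      have := (List.nodup_append.1 hn).2.1
      simp [CTree.leaves] at this
      exact this.1.1
    have e := hg m le_rfl (by simp [CTree.leaves])
    simp only [unfold, CTree.leaves, List.singleton_append, one_mul, mul_one]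
    rw [h.combSort_swap hq hxy, e.eq, hp, mul_assoc]
  | node u v ihu ihv =>
    simp only [CTree.leaves, List.append_assoc, List.length_append] at hn hg ⊢
    have e₁ := ihu (g := unfold a v (m + 1 + u.leaves.length) * g) hp (by simp [hq]) hn
      fun j h₁ h₂ => (h.tau_commute_unfold v (by omega)).mul_right (hg j h₁ (by omega))
    have e₂ := ihv (m := m + u.leaves.length) (p := p ++ u.leaves) (x := x) (g := g) (by simp [hp])
      hq (by
        refine (List.Perm.nodup_iff ?_).1 hn
        rw [List.append_assoc]
        exact (List.perm_middle.symm).append_left p) fun j h₁ h₂ => hg j (by omega) (by omega)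
    have e₃ := mul_unfold (x := tau a c) h.tau_mul_a_inv u (le_refl m)
    simp only [List.append_assoc] at e₂
    calc _ = (a (m + 1))⁻¹ * (unfold a u (m + 1) * (unfold a v (m + 1 + u.leaves.length) * g) *
          combSort a c (p ++ x :: (u.leaves ++ (v.leaves ++ q)))) := by
          simp only [unfold, mul_assoc]
      _ = (a (m + 1))⁻¹ * tau a c m * unfold a u m *
          (unfold a v (m + u.leaves.length + 1) * g *
            combSort a c (p ++ (u.leaves ++ x :: (v.leaves ++ q)))) := by
          rw [e₁, add_right_comm]; simp only [mul_assoc]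
      _ = (a (m + 1))⁻¹ * tau a c m * (unfold a u m * tau a c (m + u.leaves.length)) *
            unfold a v (m + u.leaves.length) * g *
            combSort a c (p ++ (u.leaves ++ (v.leaves ++ x :: q))) := by
          rw [e₂]; simp only [mul_assoc]
      _ = (a (m + 1))⁻¹ * tau a c m * tau a c (m + 1) * unfold a u m *
            unfold a v (m + u.leaves.length) * g *
            combSort a c (p ++ (u.leaves ++ (v.leaves ++ x :: q))) := by
          rw [← e₃]; simp only [mul_assoc]
      _ = _ := by rw [← h.tau_mul_a_inv_self]; simp only [unfold, mul_assoc]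

/-- Unfolding the trees `u` and `r` in `u(r s)`, and then sorting, amounts to exchanging them first.
The element `g` stands for what happens in `s` between unfolding and sorting. -/
theorem unfold_swap (u r : CTree) {m : ℕ} {p q : List ℕ+} {g : G}
    (hp : p.length = m) (hq : q ≠ []) (hn : (p ++ (u.leaves ++ (r.leaves ++ q))).Nodup)
    (hg : ∀ j, m ≤ j → j + 1 < m + u.leaves.length + r.leaves.length →
      Commute (tau a c j) g) :
    unfold a u m * unfold a r (m + u.leaves.length) * g *
        combSort a c (p ++ (u.leaves ++ (r.leaves ++ q))) =
      tau a c m * (unfold a r m * unfold a u (m + r.leaves.length)) * g *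
        combSort a c (p ++ (r.leaves ++ (u.leaves ++ q))) := by
  induction u generalizing m p q g with
  | leaf x =>
    have e := h.unfold_swap_leaf r (x := x) (g := g) hp hq hn fun j h₁ h₂ =>
      hg j h₁ (by simp only [CTree.leaves, List.length_singleton]; omega)
    simpa [unfold, CTree.leaves] using e
  | node u v ihu ihv =>
    simp only [CTree.leaves, List.append_assoc, List.length_append] at hn hg ⊢
    set nu := u.leaves.length
    set nv := v.leaves.length
    set nr := r.leaves.length
    have e₁ := ihv (m := m + nu) (p := p ++ u.leaves) (g := g) (by simp [hp, nu]) hq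
      (by rwa [List.append_assoc]) fun j h₁ h₂ => hg j (by omega) (by omega)
    have e₂ := ihu (g := unfold a v (m + nu + nr) * g) (q := v.leaves ++ q) hp (by simp [hq]) (by
        refine (List.Perm.nodup_iff ?_).1 hn
        refine ((List.Perm.append_left _ ?_)).append_left p
        rw [← List.append_assoc, ← List.append_assoc]
        exact List.perm_append_comm.append_right q)
      fun j h₁ h₂ => (h.tau_commute_unfold v (by omega)).mul_right (hg j h₁ (by omega))
    have e₃ := mul_unfold (x := tau a c) h.tau_mul_a_inv u (le_refl m)
    have e₄ : (a (m + 1))⁻¹ * unfold a r m = unfold a r m * (a (m + nr))⁻¹ := by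
      rw [inv_mul_eq_iff_eq_mul, ← mul_assoc, mul_unfold h.a_inv_mul_a r le_rfl,
        mul_inv_cancel_right]
    simp only [List.append_assoc] at e₁
    calc _ = (a m)⁻¹ * unfold a u m * (unfold a v (m + nu) * unfold a r (m + nu + nv) * g *
          combSort a c (p ++ (u.leaves ++ (v.leaves ++ (r.leaves ++ q))))) := by
          simp only [unfold, mul_assoc, add_assoc, nu]
      _ = (a m)⁻¹ * (unfold a u m * tau a c (m + nu)) * (unfold a r (m + nu) *
          (unfold a v (m + nu + nr) * g) *
          combSort a c (p ++ (u.leaves ++ (r.leaves ++ (v.leaves ++ q))))) := by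
          rw [e₁]; simp only [mul_assoc]
      _ = (a m)⁻¹ * tau a c (m + 1) * (unfold a u m * unfold a r (m + nu) *
          (unfold a v (m + nu + nr) * g) *
          combSort a c (p ++ (u.leaves ++ (r.leaves ++ (v.leaves ++ q))))) := by
          rw [← e₃]; simp only [mul_assoc]
      _ = (a m)⁻¹ * tau a c (m + 1) * tau a c m * unfold a r m * unfold a u (m + nr) *
          unfold a v (m + nu + nr) * g *
          combSort a c (p ++ (r.leaves ++ (u.leaves ++ (v.leaves ++ q)))) := by
          rw [e₂]; simp only [mul_assoc]
      _ = tau a c m * ((a (m + 1))⁻¹ * unfold a r m) * unfold a u (m + nr) *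
          unfold a v (m + nu + nr) * g *
          combSort a c (p ++ (r.leaves ++ (u.leaves ++ (v.leaves ++ q)))) := by
          rw [← h.tau_mul_a_inv_succ]; simp only [mul_assoc]
      _ = _ := by
          rw [e₄, add_right_comm]; simp only [unfold, mul_assoc, nu]

/-- Bringing `l r` to a sorted comb amounts to exchanging `l` and `r` first, whatever leaves `p`
precede them on the spine. It is shown to hold for all `l` and `r` in `toCombSwap`. -/
def ToCombSwap (a c : ℕ → G) (l r : CTree) : Prop :=
  ∀ p : List ℕ+, (p ++ (l.leaves ++ r.leaves)).Nodup →
    toComb a (.node l r) p.length * combSort a c (p ++ (l.leaves ++ r.leaves)) =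
      c p.length * toComb a (.node r l) p.length * combSort a c (p ++ (r.leaves ++ l.leaves))

theorem ToCombSwap.symm {l r : CTree} (hs : ToCombSwap a c l r) : ToCombSwap a c r l := by
  intro p hn
  rw [mul_assoc, hs p ((List.perm_append_comm.append_left p).nodup_iff.1 hn), ← mul_assoc,
    ← mul_assoc, h.c_mul_c, one_mul]

/-- The exchange of `u v` with `r` decomposes into the exchange of `v` with `r` and that of `u` with
`r`, by `c_eq`. -/
theorem ToCombSwap.node (u : CTree) {v r : CTree} (hs : ToCombSwap a c v r) :
    ToCombSwap a c (.node u v) r := by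
  intro p hn
  simp only [CTree.leaves, List.append_assoc] at hn ⊢
  set m := p.length with hm
  set nu := u.leaves.length with hnu
  set nv := v.leaves.length
  set nr := r.leaves.length
  have e₁ := hs (p ++ u.leaves) (by rwa [List.append_assoc])
  have hvp := v.leaves_length_pos
  have e₂ := h.unfold_swap u r (g := toComb a v (m + nu + nr)) (q := v.leaves) rfl
    (List.ne_nil_of_length_pos hvp)
    ((List.Perm.append_left _ (List.perm_append_comm.append_left _)).nodup_iff.1 hn)
    fun j _ h₂ => h.tau_commute_toComb v (by omega)
  have e₃ := mul_unfold (x := c) h.a_inv_mul_c u (le_refl m)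
  simp only [List.append_assoc, List.length_append, ← hm, ← hnu] at e₁
  simp only [← hm] at e₂
  calc _ = (a m)⁻¹ * unfold a u m * (toComb a (.node v r) (m + nu) *
        combSort a c (p ++ (u.leaves ++ (v.leaves ++ r.leaves)))) := by
        simp only [toComb, unfold, CTree.leaves, List.length_append, mul_assoc, add_assoc, nu]
    _ = (a m)⁻¹ * (unfold a u m * c (m + nu)) * (unfold a r (m + nu) * toComb a v (m + nu + nr)) *
        combSort a c (p ++ (u.leaves ++ (r.leaves ++ v.leaves))) := by
        rw [e₁]; simp only [toComb, mul_assoc, nr]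
    _ = (a m)⁻¹ * c (m + 1) * (unfold a u m * unfold a r (m + nu) * toComb a v (m + nu + nr) *
        combSort a c (p ++ (u.leaves ++ (r.leaves ++ v.leaves)))) := by
        rw [← e₃]; simp only [mul_assoc]
    _ = (a m)⁻¹ * c (m + 1) * tau a c m * (unfold a r m * unfold a u (m + nr)) *
        toComb a v (m + nu + nr) *
        combSort a c (p ++ (r.leaves ++ (u.leaves ++ v.leaves))) := by
        rw [e₂]; simp only [mul_assoc, nr]
    _ = _ := by
        rw [← h.c_eq, add_right_comm]; simp only [toComb, mul_assoc, nr, nu]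

theorem toCombSwap (l r : CTree) : ToCombSwap a c l r := by
  have key : ∀ x, ToCombSwap a c (.leaf x) r := by
    intro x
    refine ToCombSwap.symm h ?_
    induction r with
    | leaf y =>
      intro p hn
      have hxy : y ≠ x := by
        have := (List.nodup_append.1 hn).2.1
        simpa [CTree.leaves] using this
      simpa [toComb, unfold, CTree.leaves] using h.combSort_swap_last hxy
    | node u v _ ihv => exact ToCombSwap.node h u ihv
  induction l with
  | leaf x => exact key x
  | node u v _ ihv => exact ToCombSwap.node h u ihv

end IsRacPair
end Normalize

/-! ### Operators along the right spine -/

theorem onRight_eq_some {f : Op} {t t' : CTree} :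
    onRight f t = some t' ↔ ∃ l r r', t = .node l r ∧ f r = some r' ∧ t' = .node l r' := by
  cases t with
  | leaf x => exact ⟨nofun, by rintro ⟨l, r, r', h, -⟩; cases h⟩
  | node l r =>
    change (f r).map _ = _ ↔ _
    rw [Option.map_eq_some_iff]
    constructor
    · rintro ⟨r', h, rfl⟩; exact ⟨l, r, r', rfl, h, rfl⟩
    · rintro ⟨_, _, r', h, h', rfl⟩; cases h; exact ⟨r', h', rfl⟩

theorem opA_eq_some {t t' : CTree} :
    opA t = some t' ↔ ∃ t₁ t₂ t₃, t = .node t₁ (.node t₂ t₃) ∧ t' = .node (.node t₁ t₂) t₃ := by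
  constructor
  · intro h
    rcases t with x | ⟨t₁, x | ⟨t₂, t₃⟩⟩
    · cases h
    · cases h
    · cases h; exact ⟨_, _, _, rfl, rfl⟩
  · rintro ⟨t₁, t₂, t₃, rfl, rfl⟩; rfl

theorem opC_eq_some {t t' : CTree} :
    opC t = some t' ↔ ∃ t₁ t₂, t = .node t₁ t₂ ∧ t' = .node t₂ t₁ := by
  constructor
  · intro h
    rcases t with x | ⟨t₁, t₂⟩
    · cases h
    · cases h; exact ⟨_, _, rfl, rfl⟩
  · rintro ⟨t₁, t₂, rfl, rfl⟩; rfl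

/-- The operator attached to a letter. -/
def genOp (g : Gen) : Op := shift (List.replicate g.2 true) (baseOp g.1)

theorem genOp_succ (x : Letter) (i : ℕ) : genOp (x, i + 1) = onRight (genOp (x, i)) := rfl

theorem genOp_leaves_perm {g : Gen} {t t' : CTree} (ht : genOp g t = some t') :
    t.leaves.Perm t'.leaves := by
  obtain ⟨x, i⟩ := g
  induction i generalizing t t' with
  | zero =>
    cases x
    · obtain ⟨t₁, t₂, t₃, rfl, rfl⟩ := opA_eq_some.1 ht
      simp [CTree.leaves]
    · obtain ⟨t₁, t₂, rfl, rfl⟩ := opC_eq_some.1 ht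
      exact List.perm_append_comm
  | succ i ih =>
    rw [genOp_succ] at ht
    obtain ⟨l, r, r', rfl, hr, rfl⟩ := onRight_eq_some.1 ht
    exact (ih hr).append_left _

section

variable {G : Type*} [Group G]

/-- The value of a letter, given the values of the letters `a_i` and `c_i`. -/
def genValue (a c : ℕ → G) : Gen → G
  | (.a, i) => a i
  | (.c, i) => c i

/-- The normalizing elements are compatible with the operators: normalizing `t` amounts to applying
an operator and normalizing the result. -/
theorem IsRacPair.normalizer_eq {a c : ℕ → G} (h : IsRacPair a c) {g : Gen} {t t' : CTree}
    (ht : genOp g t = some t') (hn : t.leaves.Nodup) :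
    normalizer a c t = genValue a c g * normalizer a c t' := by
  obtain ⟨x, i⟩ := g
  suffices ∀ p : List ℕ+, (p ++ t.leaves).Nodup →
      toComb a t p.length * combSort a c (p ++ t.leaves) = genValue a c (x, i + p.length) *
        (toComb a t' p.length * combSort a c (p ++ t'.leaves)) by
    simpa [normalizer] using this [] hn
  clear hn
  induction i generalizing t t' with
  | zero =>
    intro p hn
    cases x
    · obtain ⟨t₁, t₂, t₃, rfl, rfl⟩ := opA_eq_some.1 ht
      simp [toComb, unfold, CTree.leaves, genValue, mul_assoc, add_assoc]
    · obtain ⟨t₁, t₂, rfl, rfl⟩ := opC_eq_some.1 ht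
      simpa [genValue, CTree.leaves, mul_assoc] using h.toCombSwap t₁ t₂ p hn
  | succ i ih =>
    intro p hn
    rw [genOp_succ] at ht
    obtain ⟨l, r, r', rfl, hr, rfl⟩ := onRight_eq_some.1 ht
    have e := ih hr (p ++ l.leaves) (by simpa [CTree.leaves] using hn)
    have e' : genValue a c (x, i + p.length + 1) * unfold a l p.length =
        unfold a l p.length * genValue a c (x, i + (p.length + l.leaves.length)) := by
      rw [← add_assoc]
      cases x
      · exact mul_unfold (x := a) h.a_inv_mul_a l (by omega)
      · exact mul_unfold (x := c) h.a_inv_mul_c l (by omega)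
    simp only [List.length_append, List.append_assoc] at e
    simp only [toComb, CTree.leaves]
    rw [add_right_comm, mul_assoc, e, mul_assoc, ← mul_assoc, ← e']
    simp only [mul_assoc]

end

/-! ### Operators defined by words -/

/-- The operator defined by a word in the letters `a_i`, `c_i` and their inverses. -/
def wordOp (L : List (Gen × Bool)) : Op :=
  (L.map fun p => cond p.2 (genOp p.1) (genOp p.1).symm).prod

theorem mul_eq_some {f g : Op} {t t' : CTree} :
    (f * g) t = some t' ↔ ∃ s, f t = some s ∧ g s = some t' :=
  Option.bind_eq_some_iff

theorem wordOp_nil_eq_some {t t' : CTree} : wordOp [] t = some t' ↔ t = t' :=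
  Option.some_inj

theorem wordOp_cons_eq_some {g : Gen} {b : Bool} {L : List (Gen × Bool)} {t t' : CTree} :
    wordOp ((g, b) :: L) t = some t' ↔
      ∃ s, (if b then genOp g t = some s else genOp g s = some t) ∧ wordOp L s = some t' := by
  change ((cond b (genOp g) (genOp g).symm) * wordOp L) t = some t' ↔ _
  rw [mul_eq_some]
  cases b
  · simp [PEquiv.eq_some_iff]
  · simp

theorem wordOp_mem (L : List (Gen × Bool)) : wordOp L ∈ geomMonoid := by
  refine list_prod_mem fun f hf => ?_
  obtain ⟨⟨g, b⟩, -, rfl⟩ := List.mem_map.1 hf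
  cases b
  exacts [symm_mem (shift_mem _ g.1), shift_mem _ g.1]

/-- The class of an operator in the geometry group. -/
def geomMk (f : geomMonoid) : GeomGroup := nearCon.toQuotient f

theorem geomMk_mul (f g : geomMonoid) : geomMk (f * g) = geomMk f * geomMk g := rfl

theorem geomMk_one : geomMk 1 = 1 := rfl

theorem geomMk_eq {f g : geomMonoid} : geomMk f = geomMk g ↔ NearEq (f : Op) g :=
  Con.eq nearCon

theorem geomMk_symm {f : Op} (hf : f ∈ geomMonoid) :
    geomMk ⟨f.symm, symm_mem hf⟩ = (geomMk ⟨f, hf⟩)⁻¹ := by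
  refine (inv_eq_of_mul_eq_one_left ?_).symm
  rw [← geomMk_mul, ← geomMk_one, geomMk_eq]
  exact nearEq_symm_mul f (tame_of_mem hf) (tame_of_mem (symm_mem hf))

theorem lift_geomGen_mk (L : List (Gen × Bool)) :
    FreeGroup.lift geomGen (FreeGroup.mk L) = geomMk ⟨wordOp L, wordOp_mem L⟩ := by
  induction L with
  | nil => rfl
  | cons p L ih =>
    obtain ⟨g, b⟩ := p
    have hg : genOp g ∈ geomMonoid := shift_mem _ _
    rw [FreeGroup.lift_mk] at ih ⊢
    rw [List.map_cons, List.prod_cons, ih]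
    cases b
    · change (geomMk ⟨genOp g, hg⟩)⁻¹ * _ = _
      rw [← geomMk_symm hg, ← geomMk_mul]; rfl
    · change geomMk ⟨genOp g, hg⟩ * _ = _
      rw [← geomMk_mul]; rfl

theorem IsRacPair.normalizer_wordOp {G : Type*} [Group G] {a c : ℕ → G} (h : IsRacPair a c)
    {L : List (Gen × Bool)} {t t' : CTree} (ht : wordOp L t = some t') (hn : t.leaves.Nodup) :
    normalizer a c t = FreeGroup.lift (genValue a c) (FreeGroup.mk L) * normalizer a c t' := by
  induction L generalizing t with
  | nil => rw [wordOp_nil_eq_some.1 ht]; simp [← FreeGroup.one_eq_mk]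
  | cons p L ih =>
    obtain ⟨g, b⟩ := p
    obtain ⟨s, hs, hs'⟩ := wordOp_cons_eq_some.1 ht
    have hns : s.leaves.Nodup := by
      refine (List.Perm.nodup_iff ?_).1 hn
      split_ifs at hs
      exacts [genOp_leaves_perm hs, (genOp_leaves_perm hs).symm]
    have e := ih hs' hns
    rw [FreeGroup.lift_mk] at e ⊢
    rw [List.map_cons, List.prod_cons, mul_assoc, ← e]
    cases b
    · rw [h.normalizer_eq (by simpa using hs) hns]; simp
    · exact h.normalizer_eq (by simpa using hs) hn

/-! ### The action of operators on the unit interval -/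

/-- The increasing affine map `[0,1) → [0,1/2)`. -/
noncomputable def leftHalf (y : UnitIco) : UnitIco :=
  ⟨y / 2, by linarith [y.2.1], by linarith [y.2.2]⟩

/-- The increasing affine map `[0,1) → [1/2,1)`. -/
noncomputable def rightHalf (y : UnitIco) : UnitIco :=
  ⟨(1 + y) / 2, by linarith [y.2.1], by linarith [y.2.2]⟩

theorem eq_half (x : UnitIco) : (∃ y, x = leftHalf y) ∨ ∃ y, x = rightHalf y := by
  by_cases h : (x : ℝ) < 1 / 2
  · exact .inl ⟨⟨2 * x, by linarith [x.2.1], by linarith⟩, Subtype.ext (by simp [leftHalf])⟩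
  · exact .inr ⟨⟨2 * x - 1, by linarith, by linarith [x.2.2]⟩, Subtype.ext (by simp [rightHalf])⟩

theorem leftHalf_lt (y : UnitIco) : (leftHalf y : ℝ) < 1 / 2 := by
  simp only [leftHalf]; linarith [y.2.2]

theorem not_rightHalf_lt (y : UnitIco) : ¬ (rightHalf y : ℝ) < 1 / 2 := by
  simp only [rightHalf]; linarith [y.2.1]

theorem leftHalf_ne_rightHalf (x y : UnitIco) : leftHalf x ≠ rightHalf y := fun h =>
  not_rightHalf_lt y (h ▸ leftHalf_lt x)

theorem leftHalf_injective : Function.Injective leftHalf := fun x y h => by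
  have := congrArg Subtype.val h
  simp only [leftHalf] at this
  exact Subtype.ext (by linarith)

theorem rightHalf_injective : Function.Injective rightHalf := fun x y h => by
  have := congrArg Subtype.val h
  simp only [rightHalf] at this
  exact Subtype.ext (by linarith)

theorem permRight_leftHalf (g : Equiv.Perm UnitIco) (y : UnitIco) :
    permRight g (leftHalf y) = leftHalf y := by
  change rightFun g _ = _
  rw [rightFun, dif_pos (leftHalf_lt y)]

theorem permRight_rightHalf (g : Equiv.Perm UnitIco) (y : UnitIco) :
    permRight g (rightHalf y) = rightHalf (g y) := by
  change rightFun g _ = _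
  rw [rightFun, dif_neg (not_rightHalf_lt y)]
  exact congrArg (fun w => rightHalf (g w)) (Subtype.ext (by simp only [rightHalf]; ring))

theorem permC_leftHalf (y : UnitIco) : permC (leftHalf y) = rightHalf y := by
  apply Subtype.ext
  change (if (leftHalf y : ℝ) < 1 / 2 then _ else _) = _
  rw [if_pos (leftHalf_lt y)]
  simp only [leftHalf, rightHalf]; ring

theorem permC_rightHalf (y : UnitIco) : permC (rightHalf y) = leftHalf y := by
  apply Subtype.ext
  change (if (rightHalf y : ℝ) < 1 / 2 then _ else _) = _
  rw [if_neg (not_rightHalf_lt y)]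
  simp only [leftHalf, rightHalf]; ring

theorem permA_leftHalf_leftHalf (y : UnitIco) : permA (leftHalf (leftHalf y)) = leftHalf y := by
  apply Subtype.ext
  have := y.2.2
  simp only [permA, leftHalf, Equiv.coe_fn_mk]
  rw [if_pos (by linarith)]; ring

theorem permA_leftHalf_rightHalf (y : UnitIco) :
    permA (leftHalf (rightHalf y)) = rightHalf (leftHalf y) := by
  apply Subtype.ext
  have h₀ := y.2.1
  have h₁ := y.2.2
  simp only [permA, leftHalf, rightHalf, Equiv.coe_fn_mk]
  rw [if_neg (by linarith), if_pos (by linarith)]; ring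

theorem permA_rightHalf (y : UnitIco) : permA (rightHalf y) = rightHalf (rightHalf y) := by
  apply Subtype.ext
  have h₀ := y.2.1
  simp only [permA, rightHalf, Equiv.coe_fn_mk]
  rw [if_neg (by linarith), if_neg (by linarith)]; ring

/-- The leaves of a tree cut `[0,1)` into standard dyadic intervals. `t.locate x` is the colour of
the leaf whose interval contains `x`, together with the position of `x` in that interval, rescaled
to `[0,1)`. -/
noncomputable def CTree.locate : CTree → UnitIco → ℕ+ × UnitIco
  | leaf i, x => (i, x)
  | node l r, x =>
    if h : (x : ℝ) < 1 / 2 then l.locate ⟨2 * x, by linarith [x.2.1], by linarith⟩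
    else r.locate ⟨2 * x - 1, by linarith, by linarith [x.2.2]⟩

namespace CTree

theorem locate_leftHalf (l r : CTree) (y : UnitIco) :
    (node l r).locate (leftHalf y) = l.locate y := by
  rw [locate, dif_pos (leftHalf_lt y)]
  congr
  simp only [leftHalf]; ring

theorem locate_rightHalf (l r : CTree) (y : UnitIco) :
    (node l r).locate (rightHalf y) = r.locate y := by
  rw [locate, dif_neg (not_rightHalf_lt y)]
  congr
  simp only [rightHalf]; ring

theorem mem_leaves_iff {t : CTree} {i : ℕ+} :
    i ∈ t.leaves ↔ ∃ x, (t.locate x).1 = i := by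
  induction t with
  | leaf j => simp [leaves, locate, eq_comm]
  | node l r ihl ihr =>
    rw [leaves, List.mem_append, ihl, ihr]
    constructor
    · rintro (⟨y, hy⟩ | ⟨y, hy⟩)
      exacts [⟨_, (congrArg _ (locate_leftHalf l r y)).trans hy⟩,
        ⟨_, (congrArg _ (locate_rightHalf l r y)).trans hy⟩]
    · rintro ⟨x, hx⟩
      obtain ⟨y, rfl⟩ | ⟨y, rfl⟩ := eq_half x
      · exact .inl ⟨y, by rwa [locate_leftHalf] at hx⟩
      · exact .inr ⟨y, by rwa [locate_rightHalf] at hx⟩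

theorem exists_locate_eq {t : CTree} {i : ℕ+} (h : i ∈ t.leaves) (z : UnitIco) :
    ∃ x, t.locate x = (i, z) := by
  induction t with
  | leaf j => exact ⟨z, by simp [leaves] at h; simp [locate, h]⟩
  | node l r ihl ihr =>
    rw [leaves, List.mem_append] at h
    obtain h | h := h
    · obtain ⟨y, hy⟩ := ihl h
      exact ⟨_, (locate_leftHalf l r y).trans hy⟩
    · obtain ⟨y, hy⟩ := ihr h
      exact ⟨_, (locate_rightHalf l r y).trans hy⟩

theorem locate_injective {t : CTree} (h : t.leaves.Nodup) : Function.Injective t.locate := by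
  induction t with
  | leaf j => exact fun x y hxy => (Prod.mk.inj hxy).2
  | node l r ihl ihr =>
    obtain ⟨hl, hr, hd⟩ := List.nodup_append.1 h
    have key : ∀ u v, l.locate u ≠ r.locate v := fun u v huv =>
      hd _ (mem_leaves_iff.2 ⟨u, rfl⟩) _ (mem_leaves_iff.2 ⟨v, rfl⟩) (by rw [huv])
    intro x y hxy
    obtain ⟨u, rfl⟩ | ⟨u, rfl⟩ := eq_half x <;> obtain ⟨v, rfl⟩ | ⟨v, rfl⟩ := eq_half y <;>
      simp only [locate_leftHalf, locate_rightHalf] at hxy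
    · rw [ihl hl hxy]
    · exact absurd hxy (key u v)
    · exact absurd hxy.symm (key v u)
    · rw [ihr hr hxy]

theorem nodup_of_locate_injective {t : CTree} (h : Function.Injective t.locate) :
    t.leaves.Nodup := by
  induction t with
  | leaf j => simp [leaves]
  | node l r ihl ihr =>
    refine List.nodup_append.2 ⟨ihl fun x y hxy => ?_, ihr fun x y hxy => ?_, ?_⟩
    · exact leftHalf_injective (h (by rwa [locate_leftHalf, locate_leftHalf]))
    · exact rightHalf_injective (h (by rwa [locate_rightHalf, locate_rightHalf]))
    · rintro i hi j hj rfl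
      obtain ⟨x, hx⟩ := exists_locate_eq hi ⟨0, by norm_num⟩
      obtain ⟨y, hy⟩ := exists_locate_eq hj ⟨0, by norm_num⟩
      refine leftHalf_ne_rightHalf x y (h ?_)
      rw [locate_leftHalf, locate_rightHalf, hx, hy]

theorem not_nodup_of_locate_eq_leaf {l r : CTree} {i : ℕ+}
    (h : (node l r).locate = (leaf i).locate) : ¬ (node l r).leaves.Nodup := by
  intro hn
  obtain ⟨-, -, hd⟩ := List.nodup_append.1 hn
  have key : ∀ x, ((node l r).locate x).1 = i := fun x => by rw [h]; rfl
  let o : UnitIco := ⟨0, by norm_num⟩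
  refine hd i (mem_leaves_iff.2 ⟨o, ?_⟩) i (mem_leaves_iff.2 ⟨o, ?_⟩) rfl
  · rw [← locate_leftHalf l r, key]
  · rw [← locate_rightHalf l r, key]

/-- A tree whose leaves have distinct colours is determined by its location map. -/
theorem eq_of_locate_eq {t t' : CTree} (h : t.leaves.Nodup) (e : t.locate = t'.locate) :
    t = t' := by
  have h' : t'.leaves.Nodup := nodup_of_locate_injective (e ▸ locate_injective h)
  induction t generalizing t' with
  | leaf i =>
    cases t' with
    | leaf j =>
      have := congrArg Prod.fst (congrFun e ⟨0, by norm_num⟩)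
      exact congrArg leaf this
    | node l r => exact absurd h' (not_nodup_of_locate_eq_leaf e.symm)
  | node l r ihl ihr =>
    cases t' with
    | leaf j => exact absurd h (not_nodup_of_locate_eq_leaf e)
    | node l' r' =>
      have hn := List.nodup_append.1 h
      have hn' := List.nodup_append.1 h'
      rw [ihl hn.1 (funext fun y => ?_) hn'.1, ihr hn.2.1 (funext fun y => ?_) hn'.2.1]
      · rw [← locate_rightHalf l r, e, locate_rightHalf]
      · rw [← locate_leftHalf l r, e, locate_leftHalf]

end CTree

/-- The permutation `φ` of `[0,1)` describes the operator `f`: whenever `f` maps `t` to `t'`, the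
map `φ` sends the interval of each leaf of `t'` to the interval of the same leaf of `t`. -/
def Describes (φ : Equiv.Perm UnitIco) (f : Op) : Prop :=
  ∀ t t', f t = some t' → ∀ x, t'.locate x = t.locate (φ x)

theorem Describes.mul {φ ψ : Equiv.Perm UnitIco} {f g : Op} (hf : Describes φ f)
    (hg : Describes ψ g) : Describes (φ * ψ) (f * g) := by
  intro t t' h x
  obtain ⟨s, hs, hs'⟩ := mul_eq_some.1 h
  rw [hg _ _ hs', hf _ _ hs]; rfl

theorem Describes.symm {φ : Equiv.Perm UnitIco} {f : Op} (hf : Describes φ f) :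
    Describes φ⁻¹ f.symm := by
  intro t t' h x
  rw [hf _ _ ((PEquiv.eq_some_iff f).1 h)]
  simp

theorem Describes.onRight {φ : Equiv.Perm UnitIco} {f : Op} (hf : Describes φ f) :
    Describes (permRight φ) (onRight f) := by
  intro t t' h x
  obtain ⟨l, r, r', rfl, hr, rfl⟩ := onRight_eq_some.1 h
  obtain ⟨y, rfl⟩ | ⟨y, rfl⟩ := eq_half x
  · rw [permRight_leftHalf, CTree.locate_leftHalf, CTree.locate_leftHalf]
  · rw [permRight_rightHalf, CTree.locate_rightHalf, CTree.locate_rightHalf, hf _ _ hr]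

theorem describes_basePerm (x : Letter) : Describes (basePerm x) (baseOp x) := by
  intro t t' h z
  cases x
  · obtain ⟨t₁, t₂, t₃, rfl, rfl⟩ := opA_eq_some.1 h
    change _ = CTree.locate _ (permA z)
    obtain ⟨y, rfl⟩ | ⟨y, rfl⟩ := eq_half z
    · obtain ⟨y, rfl⟩ | ⟨y, rfl⟩ := eq_half y <;>
        simp only [permA_leftHalf_leftHalf, permA_leftHalf_rightHalf, CTree.locate_leftHalf,
          CTree.locate_rightHalf]
    · simp only [permA_rightHalf, CTree.locate_rightHalf]
  · obtain ⟨t₁, t₂, rfl, rfl⟩ := opC_eq_some.1 h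
    change _ = CTree.locate _ (permC z)
    obtain ⟨y, rfl⟩ | ⟨y, rfl⟩ := eq_half z <;>
      simp only [permC_leftHalf, permC_rightHalf, CTree.locate_leftHalf, CTree.locate_rightHalf]

theorem describes_genOp (g : Gen) : Describes (thompsonGen g) (genOp g) := by
  obtain ⟨x, i⟩ := g
  change Describes (permRight^[i] (basePerm x)) _
  induction i with
  | zero => exact describes_basePerm x
  | succ i ih => rw [Function.iterate_succ_apply']; exact ih.onRight

theorem describes_wordOp (L : List (Gen × Bool)) :
    Describes (FreeGroup.lift thompsonGen (FreeGroup.mk L) : thompsonV) (wordOp L) := by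
  rw [FreeGroup.lift_mk]
  induction L with
  | nil =>
    intro t t' h x
    rw [wordOp_nil_eq_some.1 h]; rfl
  | cons p L ih =>
    obtain ⟨g, b⟩ := p
    refine Describes.mul (φ := ((cond b (thompsonGen g) (thompsonGen g)⁻¹ : thompsonV) :
      Equiv.Perm UnitIco)) ?_ ih
    cases b
    exacts [(describes_genOp g).symm, describes_genOp g]

/-! ### Complete trees with distinct colours -/

/-- The complete tree of height `n` whose leaves are coloured `2^n k, 2^n k + 1, …, 2^n k + 2^n - 1`
from left to right. -/
def CTree.numbered : ℕ → ℕ+ → CTree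
  | 0, k => leaf k
  | n + 1, k => node (numbered n (2 * k)) (numbered n (2 * k + 1))

namespace CTree

theorem minDepth_numbered (n : ℕ) (k : ℕ+) : (numbered n k).minDepth = n := by
  induction n generalizing k with
  | zero => rfl
  | succ n ih => simp [numbered, minDepth, ih]

/-- On the complete tree, the leaf of a point `x` and its position in that leaf are the integer part
`q` and the fractional part `z` of `2^n x`. -/
theorem locate_numbered (n : ℕ) (k : ℕ+) {q : ℕ} (hq : q < 2 ^ n) (x z : UnitIco)
    (hx : 2 ^ n * (x : ℝ) = q + z) :
    (numbered n k).locate x = (⟨2 ^ n * k + q, by positivity⟩, z) := by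
  induction n generalizing k q x with
  | zero =>
    have hq0 : q = 0 := by simpa using hq
    subst hq0
    have : x = z := Subtype.ext (by simpa using hx)
    rw [numbered, locate, this]
    exact Prod.ext (PNat.eq (by simp)) rfl
  | succ n ih =>
    have h2 : (0 : ℝ) < 2 ^ n := by positivity
    have hz₀ := z.2.1
    have hz₁ := z.2.2
    obtain ⟨y, rfl⟩ | ⟨y, rfl⟩ := eq_half x
    · have hy : 2 ^ n * (y : ℝ) = q + z := by
        rw [← hx]; simp only [leftHalf]; ring
      have hqn : q < 2 ^ n := by
        have : (q : ℝ) < 2 ^ n := by nlinarith [y.2.2]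
        exact_mod_cast this
      rw [numbered, locate_leftHalf, ih _ hqn y hy]
      congr 2
      simp only [PNat.mul_coe, PNat.val_ofNat]; ring
    · have hqn : 2 ^ n ≤ q := by
        have : (2 : ℝ) ^ n < q + 1 := by
          simp only [rightHalf] at hx
          have := mul_nonneg h2.le y.2.1
          rw [pow_succ] at hx
          linarith
        exact Nat.lt_succ_iff.1 (by exact_mod_cast this)
      obtain ⟨p, rfl⟩ := Nat.exists_eq_add_of_le hqn
      have hy : 2 ^ n * (y : ℝ) = p + z := by
        simp only [rightHalf] at hx
        push_cast at hx
        rw [pow_succ] at hx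
        linarith
      rw [numbered, locate_rightHalf, ih _ (by rw [pow_succ] at hq; omega) y hy]
      congr 2
      simp only [PNat.mul_coe, PNat.val_ofNat, PNat.add_coe]; ring

theorem numbered_leaves_nodup (n : ℕ) (k : ℕ+) : (numbered n k).leaves.Nodup := by
  have key : ∀ n k, ∀ i ∈ (numbered n k).leaves, (i : ℕ) / 2 ^ n = k := by
    intro n
    induction n with
    | zero => intro k i hi; simp [numbered, leaves] at hi; simp [hi]
    | succ n ih =>
      intro k i hi
      rw [numbered, leaves, List.mem_append] at hi
      rw [pow_succ, ← Nat.div_div_eq_div_mul]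
      obtain hi | hi := hi <;> rw [ih _ i hi] <;>
        simp only [PNat.mul_coe, PNat.val_ofNat, PNat.add_coe] <;> omega
  induction n generalizing k with
  | zero => simp [numbered, leaves]
  | succ n ih =>
    refine List.nodup_append.2 ⟨ih _, ih _, ?_⟩
    rintro i hi j hj rfl
    have := (key _ _ _ hi).symm.trans (key _ _ _ hj)
    simp only [PNat.mul_coe, PNat.val_ofNat, PNat.add_coe] at this
    omega

end CTree

/-! ### The relations hold in the geometry group -/

/-- The operator of the word `L` fixes every tree on which it is defined. -/
def IsTrivialWord (L : List (Gen × Bool)) : Prop := ∀ t t', wordOp L t = some t' → t' = t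

/-- Adding `i` to all the indices of a word. -/
def shiftWord (i : ℕ) (L : List (Gen × Bool)) : List (Gen × Bool) :=
  L.map fun p => ((p.1.1, p.1.2 + i), p.2)

theorem IsTrivialWord.lift_eq_one {L : List (Gen × Bool)} (h : IsTrivialWord L) :
    FreeGroup.lift geomGen (FreeGroup.mk L) = 1 := by
  rw [lift_geomGen_mk, ← geomMk_one, geomMk_eq]
  refine ⟨(tame_of_mem (wordOp_mem L)).exists_common tame_one, fun t h₁ _ => ?_⟩
  obtain ⟨u, hu⟩ := Option.isSome_iff_exists.1 h₁
  rw [hu, h t u hu]; rfl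

/-- Shifting the indices of a word makes it act on the right subtree. -/
theorem wordOp_shiftWord_succ {i : ℕ} {L : List (Gen × Bool)} {l r t' : CTree}
    (h : wordOp (shiftWord (i + 1) L) (.node l r) = some t') :
    ∃ r', wordOp (shiftWord i L) r = some r' ∧ t' = .node l r' := by
  induction L generalizing r with
  | nil => exact ⟨r, rfl, (wordOp_nil_eq_some.1 h).symm⟩
  | cons p L ih =>
    obtain ⟨⟨x, j⟩, b⟩ := p
    obtain ⟨s, hs, hs'⟩ := wordOp_cons_eq_some.1 h
    obtain ⟨r₁, rfl, hr₁⟩ : ∃ r₁, s = .node l r₁ ∧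
        (if b then genOp (x, j + i) r = some r₁ else genOp (x, j + i) r₁ = some r) := by
      simp only [← add_assoc, genOp_succ] at hs
      split_ifs at hs ⊢
      · obtain ⟨_, _, r₁, e, hr, rfl⟩ := onRight_eq_some.1 hs
        cases e; exact ⟨r₁, rfl, hr⟩
      · obtain ⟨_, r₁, _, rfl, hr, e⟩ := onRight_eq_some.1 hs
        cases e; exact ⟨r₁, rfl, hr⟩
    obtain ⟨r', hr', e⟩ := ih hs'
    exact ⟨r', wordOp_cons_eq_some.2 ⟨r₁, hr₁, hr'⟩, e⟩

theorem IsTrivialWord.shift {L : List (Gen × Bool)} (h : IsTrivialWord L) (i : ℕ) :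
    IsTrivialWord (shiftWord i L) := by
  induction i with
  | zero => simpa [shiftWord] using h
  | succ i ih =>
    intro t t' ht
    cases t with
    | leaf x =>
      cases L with
      | nil => exact (wordOp_nil_eq_some.1 ht).symm
      | cons p L =>
        obtain ⟨⟨x, j⟩, b⟩ := p
        obtain ⟨s, hs, -⟩ := wordOp_cons_eq_some.1 ht
        simp only [← add_assoc, genOp_succ] at hs
        split_ifs at hs
        · obtain ⟨_, _, _, e, -, -⟩ := onRight_eq_some.1 hs
          cases e
        · obtain ⟨_, _, _, -, -, e⟩ := onRight_eq_some.1 hs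
          cases e
    | node l r =>
      obtain ⟨r', hr', rfl⟩ := wordOp_shiftWord_succ ht
      rw [ih r r' hr']

theorem genOp_succ_eq_some {x : Letter} {i : ℕ} {t t' : CTree} :
    genOp (x, i + 1) t = some t' ↔
      ∃ l r r', t = .node l r ∧ genOp (x, i) r = some r' ∧ t' = .node l r' :=
  onRight_eq_some

theorem genOp_a_eq_some {t t' : CTree} : genOp (.a, 0) t = some t' ↔
    ∃ t₁ t₂ t₃, t = .node t₁ (.node t₂ t₃) ∧ t' = .node (.node t₁ t₂) t₃ :=
  opA_eq_some

theorem genOp_c_eq_some {t t' : CTree} : genOp (.c, 0) t = some t' ↔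
    ∃ t₁ t₂, t = .node t₁ t₂ ∧ t' = .node t₂ t₁ :=
  opC_eq_some

theorem lift_geomGen_shiftWord {w : FreeGroup Gen} {L : List (Gen × Bool)} (h : IsTrivialWord L)
    (i : ℕ) (hw : w = FreeGroup.mk (shiftWord i L)) : FreeGroup.lift geomGen w = 1 :=
  hw ▸ (h.shift i).lift_eq_one

theorem genOp_inj {g : Gen} {r r' s : CTree} (h : genOp g r = some s) (h' : genOp g r' = some s) :
    r = r' :=
  (genOp g).inj h h'

/-- After a shift of the indices each relation is about operators at the root, where following the
factors of a tree along the word shows that the tree is fixed. -/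
theorem lift_geomGen_relator {u v : FreeGroup Gen} (h : RacRel u v) :
    FreeGroup.lift geomGen (u * v⁻¹) = 1 := by
  cases h with
  | shift x i j h =>
    obtain ⟨k, rfl⟩ := Nat.exists_eq_add_of_le' h
    refine lift_geomGen_shiftWord (L := [((.a, 0), true), ((x, k + 1), true), ((.a, 0), false),
        ((x, k + 1 + 1), false)]) ?_ i ?_
    · intro t t' ht
      simp only [wordOp_cons_eq_some, wordOp_nil_eq_some, genOp_succ_eq_some, genOp_a_eq_some,
        if_true, Bool.false_eq_true, if_false] at ht
      grind [genOp_inj]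
    · simp [letter, FreeGroup.of, shiftWord, FreeGroup.invRev, add_comm, add_left_comm]
  | comm x i j h =>
    obtain ⟨k, rfl⟩ := Nat.exists_eq_add_of_le' h
    refine lift_geomGen_shiftWord (L := [((.c, 0), true), ((.a, 0), false), ((.c, 1), false),
        ((x, k + 1 + 1), true), ((.c, 1), true), ((.a, 0), true), ((.c, 0), false),
        ((x, k + 1 + 1), false)]) ?_ i ?_
    · intro t t' ht
      simp only [wordOp_cons_eq_some, wordOp_nil_eq_some, genOp_succ_eq_some, genOp_a_eq_some,
        genOp_c_eq_some, if_true, Bool.false_eq_true,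
        if_false] at ht
      grind [genOp_inj]
    · simp [letter, FreeGroup.of, shiftWord, FreeGroup.invRev, add_comm, add_left_comm]
  | pentagon i e h =>
    obtain rfl | rfl := h
    · refine lift_geomGen_shiftWord (L := [((.a, 1), true), ((.a, 0), true), ((.c, 0), true),
        ((.a, 1), true), ((.c, 0), false), ((.a, 0), false), ((.a, 0), false)]) ?_ i ?_
      · intro t t' ht
        simp only [wordOp_cons_eq_some, wordOp_nil_eq_some, genOp_succ_eq_some, genOp_a_eq_some,
          genOp_c_eq_some, if_true, Bool.false_eq_true,
          if_false] at ht
        grind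
      · simp [letter, FreeGroup.of, shiftWord, FreeGroup.invRev, add_comm, pow_two]
    · refine lift_geomGen_shiftWord (L := [((.a, 1), true), ((.a, 0), true), ((.c, 0), false),
        ((.a, 1), true), ((.c, 0), true), ((.a, 0), false), ((.a, 0), false)]) ?_ i ?_
      · intro t t' ht
        simp only [wordOp_cons_eq_some, wordOp_nil_eq_some, genOp_succ_eq_some, genOp_a_eq_some,
          genOp_c_eq_some, if_true, Bool.false_eq_true,
          if_false] at ht
        grind
      · simp [letter, FreeGroup.of, shiftWord, FreeGroup.invRev, add_comm, pow_two]
  | hexagon i =>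
    refine lift_geomGen_shiftWord (L := [((.a, 0), true), ((.c, 0), true), ((.c, 1), true),
        ((.a, 0), true), ((.c, 0), false), ((.c, 1), false)]) ?_ i ?_
    · intro t t' ht
      simp only [wordOp_cons_eq_some, wordOp_nil_eq_some, genOp_succ_eq_some, genOp_a_eq_some,
        genOp_c_eq_some, if_true, Bool.false_eq_true,
        if_false] at ht
      grind
    · simp [letter, FreeGroup.of, shiftWord, FreeGroup.invRev, add_comm]
  | hexagon₂ i =>
    refine lift_geomGen_shiftWord (L := [((.c, 1), true), ((.c, 0), true), ((.a, 0), false),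
        ((.c, 1), true), ((.a, 0), true), ((.c, 0), false), ((.a, 0), true),
        ((.c, 0), false)]) ?_ i ?_
    · intro t t' ht
      simp only [wordOp_cons_eq_some, wordOp_nil_eq_some, genOp_succ_eq_some, genOp_a_eq_some,
        genOp_c_eq_some, if_true, Bool.false_eq_true,
        if_false] at ht
      grind
    · simp [letter, FreeGroup.of, shiftWord, FreeGroup.invRev, add_comm]
  | torsion i =>
    refine lift_geomGen_shiftWord (L := [((.c, 0), true), ((.c, 0), true)]) ?_ i ?_
    · intro t t' ht
      simp only [wordOp_cons_eq_some, wordOp_nil_eq_some, genOp_c_eq_some, if_true] at ht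
      grind
    · simp [letter, FreeGroup.of, shiftWord, pow_two]

/-! ### The presented group -/

/-- The group presented by the relations. -/
abbrev RacGroup : Type := FreeGroup Gen ⧸ Subgroup.normalClosure relators

theorem isRacPair_mk : IsRacPair (G := RacGroup) (fun i => (letter .a i : RacGroup))
    (fun i => (letter .c i : RacGroup)) := by
  have rel : ∀ {u v : FreeGroup Gen}, RacRel u v → (u : RacGroup) = v := by
    intro u v h
    rw [QuotientGroup.eq_iff_div_mem, div_eq_mul_inv]
    exact Subgroup.subset_normalClosure ⟨u, v, h, rfl⟩
  have comm : ∀ (x : Letter) (i j : ℕ), i + 2 ≤ j →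
      Commute (tau (G := RacGroup) (fun i => (letter .a i : RacGroup))
        (fun i => (letter .c i : RacGroup)) i) (letter x j : RacGroup) := by
    intro x i j hij
    have := rel (.comm x i j hij)
    simp only [QuotientGroup.mk_mul, QuotientGroup.mk_inv] at this
    rw [Commute, SemiconjBy, tau, this]
    simp only [mul_assoc]
  exact {
    a_mul_a := fun {i j} hij => rel (.shift .a i (j + 1) (by omega))
    a_mul_c := fun {i j} hij => rel (.shift .c i (j + 1) (by omega))
    tau_comm_a := fun hij => comm .a _ _ hij
    tau_comm_c := fun hij => comm .c _ _ hij
    pentagon := fun i => by simpa using rel (.pentagon i 1 (.inl rfl))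
    hexagon := fun i => by simpa using rel (.hexagon i)
    hexagon₂ := fun i => by simpa using rel (.hexagon₂ i)
    c_mul_c := fun i => by simpa [pow_two] using rel (.torsion i) }

theorem lift_genValue_mk (w : FreeGroup Gen) :
    FreeGroup.lift (genValue (G := RacGroup) (fun i => (letter .a i : RacGroup))
      (fun i => (letter .c i : RacGroup))) w = (w : RacGroup) := by
  suffices FreeGroup.lift (genValue (G := RacGroup) (fun i => (letter .a i : RacGroup))
      (fun i => (letter .c i : RacGroup))) = QuotientGroup.mk' _ from DFunLike.congr_fun this w
  ext ⟨x, i⟩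
  cases x <;> simp [genValue, letter]

theorem exists_wordOp_numbered (L : List (Gen × Bool)) :
    ∃ n t', wordOp L (CTree.numbered n 1) = some t' := by
  obtain ⟨n, hn⟩ := (tame_of_mem (wordOp_mem L)).deep
  obtain ⟨t', h, -⟩ := hn 0 (CTree.numbered n 1) (CTree.minDepth_numbered n 1).ge
  exact ⟨n, t', h⟩

/-- A word that represents `1` in `V` maps some tree with distinct colours to itself, and hence does
not change the normalizing element of that tree. -/
theorem ker_lift_thompsonGen_le :
    (FreeGroup.lift thompsonGen).ker ≤ Subgroup.normalClosure relators := by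
  intro w hw
  obtain ⟨L, rfl⟩ := Quot.exists_rep w
  change FreeGroup.mk L ∈ _ at hw
  change FreeGroup.mk L ∈ _
  obtain ⟨n, t', ht⟩ := exists_wordOp_numbered L
  have hn := CTree.numbered_leaves_nodup n 1
  have e : (CTree.numbered n 1).locate = t'.locate := by
    funext x
    rw [describes_wordOp L _ _ ht x, MonoidHom.mem_ker.1 hw]; rfl
  obtain rfl := CTree.eq_of_locate_eq hn e
  have := isRacPair_mk.normalizer_wordOp ht hn
  rw [lift_genValue_mk] at this
  exact (QuotientGroup.eq_one_iff _).1 (mul_eq_right.1 this.symm)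

/-- A word that represents `1` in the geometry group fixes some tree with distinct colours, and the
location map of that tree is injective. -/
theorem ker_lift_geomGen_le :
    (FreeGroup.lift geomGen).ker ≤ (FreeGroup.lift thompsonGen).ker := by
  intro w hw
  obtain ⟨L, rfl⟩ := Quot.exists_rep w
  change FreeGroup.mk L ∈ _ at hw
  change FreeGroup.mk L ∈ _
  rw [MonoidHom.mem_ker, lift_geomGen_mk, ← geomMk_one, geomMk_eq] at hw
  obtain ⟨n, t', ht⟩ := exists_wordOp_numbered L
  have e := hw.2 (CTree.numbered n 1) (by simp [ht]) rfl
  rw [ht] at e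
  obtain rfl : t' = CTree.numbered n 1 := Option.some.inj e
  rw [MonoidHom.mem_ker]
  refine Subtype.ext (Equiv.ext fun x => ?_)
  exact CTree.locate_injective (CTree.numbered_leaves_nodup n 1) (describes_wordOp L _ _ ht x).symm

theorem normalClosure_le_ker_lift_geomGen :
    Subgroup.normalClosure relators ≤ (FreeGroup.lift geomGen).ker := by
  refine Subgroup.normalClosure_le_normal ?_
  rintro _ ⟨u, v, h, rfl⟩
  exact lift_geomGen_relator h

/-! ### Generation of the geometry group -/

theorem onLeft_eq (f : Op) : onLeft f = opC * (onRight f * opC) := by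
  ext t : 1
  cases t with
  | leaf x => rfl
  | node l r =>
    change (f l).map _ = ((f l).map _).bind _
    cases f l <;> rfl

theorem onRight_mul (f g : Op) : onRight (f * g) = onRight f * onRight g := by
  ext t : 1
  cases t with
  | leaf x => rfl
  | node l r =>
    change ((f r).bind g).map _ = ((f r).map _).bind _
    cases h : f r <;> rfl

theorem iterate_onRight_mul (i : ℕ) (f g : Op) :
    onRight^[i] (f * g) = onRight^[i] f * onRight^[i] g := by
  induction i with
  | zero => rfl
  | succ i ih => simp only [Function.iterate_succ_apply', ih, onRight_mul]

theorem shift_replicate_append (i : ℕ) (β : List Bool) (f : Op) :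
    shift (List.replicate i true ++ β) f = onRight^[i] (shift β f) := by
  induction i with
  | zero => rfl
  | succ i ih => rw [Function.iterate_succ_apply', ← ih]; rfl

/-- An operator at an address that contains a `0` is conjugate, by some `C_{1^i}`, to the operator
at the address where the first `0` is replaced by `1`. -/
theorem geomClass_mem_range (x : Letter) (β : List Bool) (i : ℕ) :
    geomClass x (List.replicate i true ++ β) ∈ (FreeGroup.lift geomGen).range := by
  have gen : ∀ (x : Letter) (i : ℕ), geomClass x (List.replicate i true) ∈
      (FreeGroup.lift geomGen).range := fun x i => ⟨FreeGroup.of (x, i), by simp [geomGen]⟩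
  induction β generalizing i with
  | nil => simpa using gen x i
  | cons b β ih =>
    have e : List.replicate i true ++ true :: β = List.replicate (i + 1) true ++ β := by
      rw [List.replicate_succ', List.append_assoc]; rfl
    cases b with
    | true => rw [e]; exact ih (i + 1)
    | false =>
      have key : geomClass x (List.replicate i true ++ false :: β) =
          geomClass .c (List.replicate i true) *
            (geomClass x (List.replicate (i + 1) true ++ β) *
              geomClass .c (List.replicate i true)) := by
        refine congrArg geomMk (Subtype.ext ?_)
        change shift _ _ = shift _ opC * (shift _ _ * shift _ opC)
        have hc : shift (List.replicate i true) opC = onRight^[i] opC := by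
          simpa [shift] using shift_replicate_append i [] opC
        rw [← e, shift_replicate_append, shift_replicate_append, hc, shift, shift, onLeft_eq,
          iterate_onRight_mul, iterate_onRight_mul]
      rw [key]
      exact mul_mem (gen .c i) (mul_mem (ih (i + 1)) (gen .c i))

theorem surjective_lift_geomGen : Function.Surjective (FreeGroup.lift geomGen) := by
  rw [← MonoidHom.range_eq_top, eq_top_iff]
  intro y _
  obtain ⟨⟨f, hf⟩, rfl⟩ := Con.mk'_surjective (c := nearCon) y
  change geomMk ⟨f, hf⟩ ∈ _
  induction hf using Submonoid.closure_induction with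
  | mem f h =>
    obtain ⟨α, x, rfl | rfl⟩ := h
    · exact geomClass_mem_range x α 0
    · rw [geomMk_symm (shift_mem α x)]
      exact inv_mem (geomClass_mem_range x α 0)
  | one => exact one_mem _
  | mul f g hf hg ihf ihg => exact mul_mem (ihf trivial) (ihg trivial)

/-! ### Generation of Thompson's group `V` -/

theorem permRight_mul (f g : Equiv.Perm UnitIco) :
    permRight (f * g) = permRight f * permRight g := by
  ext x : 1
  obtain ⟨y, rfl⟩ | ⟨y, rfl⟩ := eq_half x
  · simp only [Equiv.Perm.mul_apply, permRight_leftHalf]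
  · simp only [Equiv.Perm.mul_apply, permRight_rightHalf]

theorem permRight_one : permRight 1 = 1 :=
  mul_left_cancel (a := permRight 1) (by rw [← permRight_mul, mul_one, mul_one])

theorem permRight_inv (f : Equiv.Perm UnitIco) : permRight f⁻¹ = (permRight f)⁻¹ :=
  eq_inv_of_mul_eq_one_left (by rw [← permRight_mul, inv_mul_cancel, permRight_one])

/-- The subgroup generated by the elements `a_i` and `c_i` of `V`. -/
def spineSubgroup : Subgroup (Equiv.Perm UnitIco) :=
  Subgroup.closure (Set.range fun g : Gen => permRight^[g.2] (basePerm g.1))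

theorem basePerm_mem (x : Letter) : basePerm x ∈ spineSubgroup :=
  Subgroup.subset_closure ⟨(x, 0), rfl⟩

theorem permRight_mem_spineSubgroup {φ : Equiv.Perm UnitIco} (h : φ ∈ spineSubgroup) :
    permRight φ ∈ spineSubgroup := by
  induction h using Subgroup.closure_induction with
  | mem φ h =>
    obtain ⟨⟨x, i⟩, rfl⟩ := h
    exact Subgroup.subset_closure ⟨(x, i + 1), Function.iterate_succ_apply' _ _ _⟩
  | one => rw [permRight_one]; exact one_mem _
  | mul f g _ _ hf hg => rw [permRight_mul]; exact mul_mem hf hg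
  | inv f _ hf => rw [permRight_inv]; exact inv_mem hf

/-- Two trees are equivalent up to associativity and commutativity. -/
inductive ACEquiv : CTree → CTree → Prop
  | refl (t) : ACEquiv t t
  | symm {t t'} : ACEquiv t t' → ACEquiv t' t
  | trans {t t' t''} : ACEquiv t t' → ACEquiv t' t'' → ACEquiv t t''
  | assoc (t₁ t₂ t₃) : ACEquiv (.node t₁ (.node t₂ t₃)) (.node (.node t₁ t₂) t₃)
  | comm (t₁ t₂) : ACEquiv (.node t₁ t₂) (.node t₂ t₁)
  | right (l) {r r'} : ACEquiv r r' → ACEquiv (.node l r) (.node l r')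

namespace ACEquiv

theorem left {l l' : CTree} (r : CTree) (h : ACEquiv l l') : ACEquiv (.node l r) (.node l' r) :=
  ((comm l r).trans (h.right r)).trans (comm r l')

theorem swap (t₁ t₂ t₃ : CTree) :
    ACEquiv (.node t₁ (.node t₂ t₃)) (.node t₂ (.node t₁ t₃)) :=
  ((assoc t₁ t₂ t₃).trans ((comm t₁ t₂).left t₃)).trans (assoc t₂ t₁ t₃).symm

end ACEquiv

/-- The tree `x₁(x₂(⋯(x_n s)))`, where `x₁, …, x_n` are the entries of `l`. -/
def combOnto (l : List ℕ+) (s : CTree) : CTree := l.foldr (fun x s => .node (.leaf x) s) s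

theorem combOnto_append (l l' : List ℕ+) (s : CTree) :
    combOnto (l ++ l') s = combOnto l (combOnto l' s) :=
  List.foldr_append

namespace ACEquiv

theorem combOnto {s s' : CTree} (l : List ℕ+) (h : ACEquiv s s') :
    ACEquiv (combOnto l s) (combOnto l s') := by
  induction l with
  | nil => exact h
  | cons x l ih => exact ih.right _

theorem node_combOnto (t s : CTree) : ACEquiv (.node t s) (ACGeometry.combOnto t.leaves s) := by
  induction t generalizing s with
  | leaf x => exact refl _
  | node u v ihu ihv =>
    rw [CTree.leaves, combOnto_append]
    exact ((assoc u v s).symm.trans ((ihv s).right u)).trans (ihu _)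

theorem exists_combOnto (t : CTree) : ∃ l x, t.leaves = l ++ [x] ∧
    ACEquiv t (ACGeometry.combOnto l (.leaf x)) := by
  induction t with
  | leaf x => exact ⟨[], x, rfl, refl _⟩
  | node u v _ ihv =>
    obtain ⟨l, x, e, h⟩ := ihv
    refine ⟨u.leaves ++ l, x, by rw [CTree.leaves, e, List.append_assoc], ?_⟩
    rw [combOnto_append]
    exact (h.right u).trans (node_combOnto u _)

theorem combOnto_perm {l l' : List ℕ+} (h : l.Perm l') (s : CTree) :
    ACEquiv (ACGeometry.combOnto l s) (ACGeometry.combOnto l' s) := by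
  induction h with
  | nil => exact refl _
  | cons x _ ih => exact ih.right _
  | swap x y l => exact swap _ _ _
  | trans _ _ ih ih' => exact ih.trans ih'

/-- Trees with the same leaves up to order are equivalent. -/
theorem of_perm {t t' : CTree} (h : t.leaves.Perm t'.leaves) : ACEquiv t t' := by
  obtain ⟨l, x, e, ht⟩ := exists_combOnto t
  obtain ⟨l', y, e', ht'⟩ := exists_combOnto t'
  rw [e, e'] at h
  refine (ht.trans ?_).trans ht'.symm
  by_cases hxy : x = y
  · subst hxy
    exact combOnto_perm ((List.perm_append_right_iff _).1 h) _
  · have hy : y ∈ l := by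
      have : y ∈ l ++ [x] := h.mem_iff.2 (by simp)
      simpa [Ne.symm hxy] using this
    have h₁ : l.Perm (l.erase y ++ [y]) :=
      (List.perm_cons_erase hy).trans (List.perm_append_singleton _ _).symm
    have h₂ : (l.erase y ++ [x]).Perm l' := by
      refine (List.perm_append_right_iff [y]).1 (List.Perm.trans ?_ h)
      refine List.Perm.trans ?_ (h₁.symm.append_right [x])
      rw [List.append_assoc, List.append_assoc]
      exact List.perm_append_comm.append_left _
    refine (combOnto_perm h₁ _).trans (ACEquiv.trans ?_ (combOnto_perm h₂ _))
    rw [combOnto_append, combOnto_append]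
    exact (comm _ _).combOnto _

theorem exists_perm {t t' : CTree} (h : ACEquiv t t') :
    ∃ φ ∈ spineSubgroup, ∀ x, t'.locate x = t.locate (φ x) := by
  induction h with
  | refl t => exact ⟨1, one_mem _, fun x => rfl⟩
  | symm _ ih =>
    obtain ⟨φ, hφ, h⟩ := ih
    exact ⟨φ⁻¹, inv_mem hφ, fun x => by rw [h]; simp⟩
  | trans _ _ ih ih' =>
    obtain ⟨φ, hφ, h⟩ := ih
    obtain ⟨ψ, hψ, h'⟩ := ih'
    exact ⟨φ * ψ, mul_mem hφ hψ, fun x => by rw [h', h]; rfl⟩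
  | assoc t₁ t₂ t₃ => exact ⟨_, basePerm_mem .a, describes_basePerm .a _ _ rfl⟩
  | comm t₁ t₂ => exact ⟨_, basePerm_mem .c, describes_basePerm .c _ _ rfl⟩
  | right l _ ih =>
    obtain ⟨φ, hφ, h⟩ := ih
    refine ⟨permRight φ, permRight_mem_spineSubgroup hφ, fun x => ?_⟩
    obtain ⟨y, rfl⟩ | ⟨y, rfl⟩ := eq_half x
    · rw [permRight_leftHalf, CTree.locate_leftHalf, CTree.locate_leftHalf]
    · rw [permRight_rightHalf, CTree.locate_rightHalf, CTree.locate_rightHalf, h]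

end ACEquiv

/-- A map is the location map of a tree as soon as, around every point, it is the location map of
a leaf on some standard dyadic interval `[q/2^n, (q+1)/2^n)`, with `n` bounded. -/
theorem exists_locate_eq_of_dyadic (m : ℕ) (p : UnitIco → ℕ+ × UnitIco)
    (h : ∀ x : UnitIco, ∃ n ≤ m, ∃ (q : ℕ) (i : ℕ+) (z : UnitIco), 2 ^ n * (x : ℝ) = q + z ∧
      ∀ y y' : UnitIco, 2 ^ n * (y : ℝ) = q + y' → p y = (i, y')) :
    ∃ t : CTree, t.locate = p := by
  induction m generalizing p with
  | zero =>
    obtain ⟨n, hn, q, i, z, hx, hp⟩ := h ⟨0, by norm_num⟩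
    obtain rfl : n = 0 := by omega
    have hq : q = 0 := by
      have := z.2.1
      have hq : (q : ℝ) ≤ 0 := by simp at hx; linarith
      exact_mod_cast hq.antisymm q.cast_nonneg
    exact ⟨.leaf i, funext fun y => (hp y y (by simp [hq])).symm⟩
  | succ m ih =>
    by_cases hleaf : ∃ i, (CTree.leaf i).locate = p
    · exact ⟨_, hleaf.choose_spec⟩
    -- The intervals are proper ones, since otherwise `p` would be the location map of a leaf.
    have hpos : ∀ x : UnitIco, ∃ n ≤ m, ∃ (q : ℕ) (i : ℕ+) (z : UnitIco),
        2 ^ (n + 1) * (x : ℝ) = q + z ∧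
        ∀ y y' : UnitIco, 2 ^ (n + 1) * (y : ℝ) = q + y' → p y = (i, y') := by
      intro x
      obtain ⟨n, hn, q, i, z, hx, hp⟩ := h x
      cases n with
      | succ n => exact ⟨n, by omega, q, i, z, hx, hp⟩
      | zero =>
        refine absurd ⟨i, funext fun y => (hp y y ?_).symm⟩ hleaf
        have hq : (q : ℝ) < 1 := by
          have := x.2.2
          have := z.2.1
          simp only [pow_zero, one_mul] at hx
          linarith
        have : q = 0 := Nat.lt_one_iff.1 (by exact_mod_cast hq)
        simp [this]
    obtain ⟨l, hl⟩ := ih (fun y => p (leftHalf y)) fun x => by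
      obtain ⟨n, hn, q, i, z, hx, hp⟩ := hpos (leftHalf x)
      refine ⟨n, hn, q, i, z, ?_, fun y y' hy => hp _ _ ?_⟩
      · rw [← hx, leftHalf]; ring
      · rw [← hy, leftHalf]; ring
    obtain ⟨r, hr⟩ := ih (fun y => p (rightHalf y)) fun x => by
      obtain ⟨n, hn, q, i, z, hx, hp⟩ := hpos (rightHalf x)
      have hx' : 2 ^ n + 2 ^ n * (x : ℝ) = q + z := by rw [← hx, rightHalf]; ring
      have hq : 2 ^ n ≤ q := by
        have h₁ := z.2.2
        have h₂ : (0 : ℝ) ≤ 2 ^ n * (x : ℝ) := mul_nonneg (by positivity) x.2.1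
        have : (2 : ℝ) ^ n < q + 1 := by linarith
        exact Nat.lt_succ_iff.1 (by exact_mod_cast this)
      obtain ⟨q, rfl⟩ := Nat.exists_eq_add_of_le hq
      push_cast at hx' hp
      refine ⟨n, hn, q, i, z, by linarith, fun y y' hy => hp _ _ ?_⟩
      rw [add_assoc, ← hy, rightHalf]; ring
    refine ⟨.node l r, funext fun x => ?_⟩
    obtain ⟨y, rfl⟩ | ⟨y, rfl⟩ := eq_half x
    · rw [CTree.locate_leftHalf, hl]
    · rw [CTree.locate_rightHalf, hr]

/-- A dyadic piecewise linear bijection maps the intervals of the leaves of some complete tree to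
the intervals of the leaves of another tree. -/
theorem exists_locate_eq_comp_inv {g : Equiv.Perm UnitIco} (hg : IsDyadicPL g) :
    ∃ (N : ℕ) (t : CTree), t.locate = (CTree.numbered N 1).locate ∘ (g⁻¹ : Equiv.Perm _) := by
  obtain ⟨n, M, h⟩ := hg.exists_level
  -- The images of the intervals of level `N` have levels between `M` and `N + M`.
  set N := n + 2 * M with hN
  have h2N : (0 : ℝ) < 2 ^ N := by positivity
  refine ⟨N, exists_locate_eq_of_dyadic (N + M) _ fun x => ?_⟩
  set x₀ := g⁻¹ x with hx₀
  have hgx : g x₀ = x := g.apply_symm_apply x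
  obtain ⟨k, d, hk, -, hd, hk'⟩ := h x₀
  have hk := abs_le.1 hk
  obtain ⟨r, hr⟩ := Int.eq_ofNat_of_zero_le (show 0 ≤ (N : ℤ) - k by omega)
  have hrk : (2 : ℝ) ^ r * 2 ^ k = 2 ^ N := by
    rw [← zpow_natCast, ← zpow_natCast, ← zpow_add₀ two_ne_zero]
    congr 1; omega
  obtain ⟨D, hD⟩ := hd r (by omega)
  have h2r : (0 : ℝ) < 2 ^ r := by positivity
  obtain ⟨q₀, hq₀⟩ := Int.eq_ofNat_of_zero_le
    (Int.floor_nonneg.2 (mul_nonneg h2N.le x₀.2.1))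
  have hfl := Int.floor_le (2 ^ N * (x₀ : ℝ))
  have hfl' := Int.lt_floor_add_one (2 ^ N * (x₀ : ℝ))
  rw [hq₀] at hfl hfl'
  have hfl : (q₀ : ℝ) ≤ 2 ^ N * (x₀ : ℝ) := by exact_mod_cast hfl
  have hfl' : 2 ^ N * (x₀ : ℝ) < q₀ + 1 := by exact_mod_cast hfl'
  have hq₀N : q₀ < 2 ^ N := by
    have : (q₀ : ℝ) < 2 ^ N := by nlinarith [x₀.2.2]
    exact_mod_cast this
  -- The affine map, in the coordinates of the two standard dyadic intervals.
  have aff : ∀ w : UnitIco, ⌊2 ^ N * (w : ℝ)⌋ = q₀ → 2 ^ r * (g w : ℝ) = 2 ^ N * w + D := by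
    intro w hw
    rw [hk' w (floor_coarsen (N := N) (by omega) (hw.trans hq₀.symm)), ← hD, ← hrk]
    ring
  have hx := aff x₀ hq₀
  rw [hgx] at hx
  obtain ⟨q, hq⟩ := Int.eq_ofNat_of_zero_le (show 0 ≤ q₀ + D by
    have h₁ : (0 : ℝ) ≤ 2 ^ r * x := mul_nonneg h2r.le x.2.1
    have h₂ : (-1 : ℝ) < q₀ + D := by linarith
    have : (-1 : ℤ) < q₀ + D := by exact_mod_cast h₂
    omega)
  have hq' : (q : ℝ) = q₀ + D := by exact_mod_cast hq.symm
  refine ⟨r, by omega, q, ⟨2 ^ N * (1 : ℕ+) + q₀, by positivity⟩,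
    ⟨2 ^ N * x₀ - q₀, by linarith, by linarith⟩, by rw [hx, hq']; ring, fun y y' hy => ?_⟩
  have hy₀ := y'.2.1
  have hy₁ := y'.2.2
  have hw : ((q₀ : ℝ) + (y' : ℝ)) / 2 ^ N ∈ Set.Ico (0 : ℝ) 1 := by
    refine ⟨div_nonneg (add_nonneg q₀.cast_nonneg hy₀) h2N.le, (div_lt_one h2N).2 ?_⟩
    have : (q₀ : ℝ) + 1 ≤ 2 ^ N := by exact_mod_cast hq₀N
    linarith
  have hw' : 2 ^ N * ((q₀ + y') / 2 ^ N : ℝ) = q₀ + y' := by field_simp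
  have hgw : g ⟨_, hw⟩ = y := by
    have e := aff ⟨_, hw⟩ (by
      rw [hw', Int.floor_eq_iff]
      exact ⟨by push_cast; linarith, by push_cast; linarith⟩)
    rw [hw'] at e
    exact Subtype.ext (mul_left_cancel₀ h2r.ne' (by rw [e, hy, hq']; ring))
  rw [Function.comp_apply, show g⁻¹ y = ⟨_, hw⟩ from (Equiv.symm_apply_eq g).2 hgw.symm]
  exact CTree.locate_numbered N 1 hq₀N _ y' hw'

theorem thompsonV_le_spineSubgroup : thompsonV ≤ spineSubgroup := by
  intro g hg
  obtain ⟨N, t, ht⟩ := exists_locate_eq_comp_inv hg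
  have inj := CTree.locate_injective (CTree.numbered_leaves_nodup N 1)
  have hn : t.leaves.Nodup := CTree.nodup_of_locate_injective
    (ht ▸ inj.comp (g⁻¹ : Equiv.Perm _).injective)
  have hp : (CTree.numbered N 1).leaves.Perm t.leaves := by
    refine (List.perm_ext_iff_of_nodup (CTree.numbered_leaves_nodup N 1) hn).2 fun i => ?_
    rw [CTree.mem_leaves_iff, CTree.mem_leaves_iff, ht]
    exact (g⁻¹ : Equiv.Perm _).surjective.exists
  obtain ⟨φ, hφ, h⟩ := (ACEquiv.of_perm hp).exists_perm
  have : g⁻¹ = φ := Equiv.ext fun x => inj (by rw [← h, ht]; rfl)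
  exact inv_mem_iff.1 (this ▸ hφ)

theorem surjective_lift_thompsonGen : Function.Surjective (FreeGroup.lift thompsonGen) := by
  rw [← MonoidHom.range_eq_top, eq_top_iff]
  intro g _
  have h : (g : Equiv.Perm UnitIco) ∈
      ((FreeGroup.lift thompsonGen).range).map thompsonV.subtype := by
    refine (Subgroup.closure_le _).2 ?_ (thompsonV_le_spineSubgroup g.2)
    rintro _ ⟨x, rfl⟩
    exact ⟨thompsonGen x, ⟨FreeGroup.of x, by simp⟩, rfl⟩
  obtain ⟨g', hg', e⟩ := h
  rwa [← Subtype.ext e]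

end ACGeometry

/-- The relations `R_ac` completed with the torsion relations `c_i² = 1` make a presentation of the
geometry group of associativity and commutativity in terms of its generators
`a_i = A_{1^{i-1}}` and `c_i = C_{1^{i-1}}`, that is, of Thompson's group `V` in terms of the
corresponding generators. -/
theorem proposition3p20 :
    ACGeometry.IsPresentation ACGeometry.geomGen ACGeometry.relators ∧
      ACGeometry.IsPresentation ACGeometry.thompsonGen ACGeometry.relators := by
  open ACGeometry in
  have h₁ := normalClosure_le_ker_lift_geomGen
  have h₂ := ker_lift_geomGen_le
  have h₃ := ker_lift_thompsonGen_le
  exact ⟨⟨surjective_lift_geomGen, (h₂.trans h₃).antisymm h₁⟩,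
    ⟨surjective_lift_thompsonGen, h₃.antisymm (h₁.trans h₂)⟩⟩
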